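/- Theorem 1. Let $P$ be a nonconstant real polynomial all of whose complex zeros are positive real numbers, with $P(0)>0$, and let $r$ be a positive integer such that $\max(\deg P,r)>1$. Let $H_m(z)$, $m\ge 0$, be the real polynomials generated by $$\sum_{m=0}^{\infty}H_m(z)t^m=\frac{1}{P(t)+zt^r},$$ and put $$R(t)=t^{2r}\,\frac{d}{dt}\left(-\frac{P(t)}{t^r}\right)=r\,t^{r-1}P(t)-t^rP'(t).$$ Then the polynomial $R$ has a smallest positive real zero $t_a$ and a largest nonpositive real zero $t_b$. Let $$a=-\frac{P(t_a)}{t_a^r},\qquad b=\begin{cases}-P(t_b)/t_b&\text{if }t_b\ne 0,\\ \infty&\text{if }t_b=0.\end{cases}$$ There is an integer $M$ (depending on $P$ and $r$) such that for every $m\ge M$ all complex zeros of $H_m$ are real and lie in the interval $(a,b)$. Moreover, for every $M$, the set $\bigcup_{m\ge M}\{z\in\mathbb{R} : H_m(z)=0\}$ of zeros is dense in $(a,b)$, that is, its closure contains $(a,b)$. -/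

import Mathlib

open Polynomial

/-- The denominator `P(t) + z t ^ r`, as a formal power series in `t` over the ring `ℝ[z]`. -/
noncomputable def genDenom (P : ℝ[X]) (r : ℕ) : PowerSeries ℝ[X] :=
  ((P.map (C : ℝ →+* ℝ[X]) : ℝ[X][X]) : PowerSeries ℝ[X])
    + PowerSeries.C (X : ℝ[X]) * PowerSeries.X ^ r

/-- `genPoly P r m` is the polynomial `H_m(z)`: the coefficient of `t ^ m` in the power series
`1 / (P(t) + z t ^ r)`. The inverse is a true inverse as soon as `P(0) ≠ 0` and `r ≥ 1`,
see `genPoly_spec`. -/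
noncomputable def genPoly (P : ℝ[X]) (r m : ℕ) : ℝ[X] :=
  PowerSeries.coeff m (Ring.inverse (genDenom P r))

theorem genPoly_spec (P : ℝ[X]) (r : ℕ) (hr : 1 ≤ r) (hP : P.eval 0 ≠ 0) :
    genDenom P r * PowerSeries.mk (genPoly P r) = 1 := by
  have h1 : PowerSeries.mk (genPoly P r) = Ring.inverse (genDenom P r) := by
    ext1 m
    simp [genPoly]
  rw [h1]
  apply Ring.mul_inverse_cancel
  rw [PowerSeries.isUnit_iff_constantCoeff]
  have h2 : PowerSeries.constantCoeff (genDenom P r) = C (P.eval 0) := by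
    have hr' : r ≠ 0 := by omega
    rw [genDenom, map_add, Polynomial.constantCoeff_coe, Polynomial.coeff_map,
      Polynomial.coeff_zero_eq_eval_zero]
    simp [hr']
  rw [h2]
  exact (isUnit_iff_ne_zero.mpr hP).map C

/-- The polynomial `R(t) = t ^ (2 r) * d/dt (-P(t) / t ^ r) = r t ^ (r - 1) P(t) - t ^ r P'(t)`,
whose zeros are the "critical points" of `-P(t) / t ^ r` (for `r > 1` this includes `t = 0`). -/
noncomputable def critPoly (P : ℝ[X]) (r : ℕ) : ℝ[X] :=
  C (r : ℝ) * X ^ (r - 1) * P - X ^ r * derivative P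

theorem critPoly_eval_eq (P : ℝ[X]) (r : ℕ) {t : ℝ} (ht : t ≠ 0) :
    (critPoly P r).eval t = t ^ (2 * r) * deriv (fun s : ℝ => -P.eval s / s ^ r) t := by
  have h : HasDerivAt (fun s : ℝ => -P.eval s / s ^ r)
      ((-(derivative P).eval t * t ^ r - -P.eval t * (r * t ^ (r - 1))) / (t ^ r) ^ 2) t :=
    (P.hasDerivAt t).neg.div (hasDerivAt_pow r t) (pow_ne_zero r ht)
  rw [h.deriv]
  have h0 : t ^ r ≠ 0 := pow_ne_zero r ht
  have h1 : t ^ (2 * r) = (t ^ r) ^ 2 := by rw [mul_comm, pow_mul]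
  rw [h1, mul_div_cancel₀ _ (pow_ne_zero 2 h0)]
  simp [critPoly]
  ring

/-- The left end point `a = -P(t_a) / t_a ^ r`. -/
noncomputable def leftEnd (P : ℝ[X]) (r : ℕ) (ta : ℝ) : ℝ :=
  -P.eval ta / ta ^ r

/-- The right end point: `b = -P(t_b) / t_b` if `t_b ≠ 0`, and `b = ∞` if `t_b = 0`. -/
noncomputable def rightEnd (P : ℝ[X]) (tb : ℝ) : EReal :=
  if tb = 0 then ⊤ else ((-P.eval tb / tb : ℝ) : EReal)

/-! Normalize `P = p₀ ∏ (1 - y i X)` with `y` decreasing, and put `F = p₀ / (P + z X ^ r)`, so that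
`∏ (1 - y i X) F = 1 + ζ X ^ r F` with `ζ = -z / p₀`. Peeling off one linear factor at a time gives
a triangular recurrence for the coefficients of `F` times the partial products.

Reality: if `Im ζ > 0`, a sliding window of `r + n` of these coefficients stays ordered by argument,
within an angle less than `π`. Each step only moves the first entry, multiplied by `ζ`, to the end,
and replaces entries by positive combinations with their neighbours. This forces every coefficient
of `F` to be nonzero (`ArgRecurrence.pairwise_window`). Letting `Im z → 0` leaves a trace at real
`z`: certain triples of coefficients cannot have signs `+, -, +`.

Location: for `x ≤ a` the coefficients are positive, and for `r = 1`, `x ≥ b` they alternate in sign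
(`coeff_pos_of_mul_eq_one`).

Density: on a circle `|1 - y i z|` is strictly decreasing in `Re z`, so the zeros of least modulus
of the denominator are one real number or one conjugate pair. For `a < x < b` a simple real one is
impossible: it would be noncritical for `a` and `b`, and then the coefficients would show a
forbidden sign pattern (`false_of_real_min_root`). So for all but finitely many such `x`, `H_m(x)`
oscillates like `Re (β ω ^ m)` up to scale, with `ω` nonreal. On an interval without zeros of `H_m`,
`m ≥ M`, the values at two points have equal signs, although `ω` varies with `x`; Cesàro means rule
this out (`false_of_eventually_mul_nonneg`). -/

/-! ### Ordering by argument and the triangular recurrence. -/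

/-- `ArgOrdered ζ u v`: the arguments of `u`, `v`, `ζ u` increase, in this order. -/
def ArgOrdered (ζ u v : ℂ) : Prop :=
  0 ≤ (starRingEnd ℂ u * v).im ∧ 0 ≤ (starRingEnd ℂ v * (ζ * u)).im

namespace ArgOrdered

variable {ζ u v w : ℂ}

theorem refl (hζ : 0 < ζ.im) (u : ℂ) : ArgOrdered ζ u u := by
  constructor
  · simp; ring_nf; rfl
  · simp only [Complex.mul_im, Complex.mul_re, Complex.conj_re, Complex.conj_im]
    nlinarith [mul_nonneg hζ.le (add_nonneg (sq_nonneg u.re) (sq_nonneg u.im))]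

theorem mul_left (h : ArgOrdered ζ u v) : ArgOrdered ζ v (ζ * u) := by
  refine ⟨h.2, ?_⟩
  have h1 := mul_nonneg (add_nonneg (sq_nonneg ζ.re) (sq_nonneg ζ.im)) h.1
  simp only [Complex.mul_im, Complex.mul_re, Complex.conj_re, Complex.conj_im] at h1 ⊢
  nlinarith

theorem add_right {y : ℝ} (hy : 0 ≤ y) (hu : ArgOrdered ζ w u) (hv : ArgOrdered ζ w v) :
    ArgOrdered ζ w (y * u + v) := by
  obtain ⟨h1, h2⟩ := hu
  obtain ⟨h3, h4⟩ := hv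
  have h1 := mul_nonneg hy h1
  have h2 := mul_nonneg hy h2
  constructor <;>
  · simp only [Complex.mul_im, Complex.mul_re, Complex.conj_re, Complex.conj_im, Complex.add_re,
      Complex.add_im, Complex.ofReal_re, Complex.ofReal_im, map_add] at *
    nlinarith

theorem add_left {y : ℝ} (hy : 0 ≤ y) (hu : ArgOrdered ζ u w) (hv : ArgOrdered ζ v w) :
    ArgOrdered ζ (y * u + v) w := by
  obtain ⟨h1, h2⟩ := hu
  obtain ⟨h3, h4⟩ := hv
  have h1 := mul_nonneg hy h1
  have h2 := mul_nonneg hy h2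
  constructor <;>
  · simp only [Complex.mul_im, Complex.mul_re, Complex.conj_re, Complex.conj_im, Complex.add_re,
      Complex.add_im, Complex.ofReal_re, Complex.ofReal_im, map_add] at *
    nlinarith

/-- If `v = -y u`, then `conj v * ζ u = -y |u|² ζ` lies in the open lower half-plane. -/
theorem add_ne_zero (hζ : 0 < ζ.im) (h : ArgOrdered ζ u v) (hu : u ≠ 0) {y : ℝ} (hy : 0 < y) :
    y * u + v ≠ 0 := by
  intro h0
  have hv : v = -(y * u) := by linear_combination h0
  have h2 := h.2
  rw [hv] at h2
  have hpos : 0 < u.re ^ 2 + u.im ^ 2 := by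
    have := Complex.normSq_pos.mpr hu
    rw [Complex.normSq_apply] at this
    nlinarith
  have := mul_pos (mul_pos hy hζ) hpos
  simp only [Complex.mul_im, Complex.mul_re, Complex.conj_re, Complex.conj_im, Complex.neg_re,
      Complex.neg_im, Complex.ofReal_re, Complex.ofReal_im, map_neg, map_mul,
      Complex.conj_ofReal] at h2
  nlinarith

/-- The three arguments span less than `π`, too little to leave the right half-plane, cross the left
one and return. -/
theorem not_sign_pattern (hζ : 0 < ζ.im) (huv : ArgOrdered ζ u v) (hvw : ArgOrdered ζ v w)
    (huw : ArgOrdered ζ u w) (hu : 0 < u.re) (hv : v.re < 0) (hw : 0 < w.re) : False := by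
  obtain ⟨h1, h2⟩ := huv
  have h3 := hvw.1
  have h4 := huw.1
  simp only [Complex.mul_im, Complex.mul_re, Complex.conj_re, Complex.conj_im] at h1 h2 h3 h4
  -- The Plücker relation between the cross products of `u`, `v`, `w` and their real parts. Its
  -- sides have opposite signs, so `u` and `v` are parallel; being opposite, they violate `h2`.
  have e1 : (u.re * w.im + -u.im * w.re) * v.re
      = (u.re * v.im + -u.im * v.re) * w.re + (v.re * w.im + -v.im * w.re) * u.re := by ring
  have h5 : (u.re * v.im + -u.im * v.re) * w.re ≤ 0 := by
    nlinarith [mul_nonneg h3 hu.le, mul_nonneg h4 (neg_nonneg.mpr hv.le)]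
  have h6 : u.re * v.im + -u.im * v.re = 0 := by
    nlinarith [nonneg_of_mul_nonneg_left (a := -(u.re * v.im + -u.im * v.re)) (b := w.re)
      (by linarith) hw]
  have h7 : v.im * u.re = u.im * v.re := by linarith
  have h8 : u.re * (v.re * (ζ.re * u.im + ζ.im * u.re) + -v.im * (ζ.re * u.re - ζ.im * u.im))
      = v.re * ζ.im * (u.re ^ 2 + u.im ^ 2) := by
    linear_combination (-(ζ.re * u.re - ζ.im * u.im)) * h7
  have h9 : 0 < ζ.im * (u.re ^ 2 + u.im ^ 2) := by positivity
  nlinarith [mul_nonneg hu.le h2]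

theorem smul_real (h : ArgOrdered ζ u v) (σ : ℝ) : ArgOrdered ζ (σ * u) (σ * v) := by
  obtain ⟨h1, h2⟩ := h
  have h1 := mul_nonneg (sq_nonneg σ) h1
  have h2 := mul_nonneg (sq_nonneg σ) h2
  constructor <;>
  · simp only [Complex.mul_im, Complex.mul_re, Complex.conj_re, Complex.conj_im,
      Complex.ofReal_re, Complex.ofReal_im] at *
    nlinarith

end ArgOrdered

/-- Both inequalities are linear in each variable, hence stable under positive combinations. Order
is kept for all pairs because `ArgOrdered` is not transitive. -/
theorem pairwise_insert_comb {ζ : ℂ} (hζ : 0 < ζ.im) {y : ℝ} (hy : 0 ≤ y) {L₁ L₂ : List ℂ}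
    {u v : ℂ} (h : (L₁ ++ u :: v :: L₂).Pairwise (ArgOrdered ζ)) :
    (L₁ ++ (y * u + v) :: v :: L₂).Pairwise (ArgOrdered ζ) := by
  simp only [List.pairwise_append, List.pairwise_cons, List.mem_cons] at h ⊢
  obtain ⟨h1, ⟨h2, h3, h4⟩, h5⟩ := h
  refine ⟨h1, ⟨?_, h3, h4⟩, ?_⟩
  · rintro a (rfl | ha)
    · exact (h2 a (Or.inl rfl)).add_left hy (.refl hζ a)
    · exact (h2 a (Or.inr ha)).add_left hy (h3 a ha)
  · rintro a ha b (rfl | rfl | hb)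
    · exact (h5 a ha u (Or.inl rfl)).add_right hy (h5 a ha v (Or.inr (Or.inl rfl)))
    · exact h5 a ha b (Or.inr (Or.inl rfl))
    · exact h5 a ha b (Or.inr (Or.inr hb))

/-- The window `A (m+1), …, A (m+r), G 0 m, …, G (n-1) m` of the triangular recurrence in
`ArgRecurrence`. -/
def argWindow (A : ℕ → ℂ) (G : ℕ → ℕ → ℂ) (r n m : ℕ) : List ℂ :=
  (List.range' (m + 1) r).map A ++ (List.range' 0 n).map (G · m)

/-- The triangular recurrence satisfied by the coefficients of `F` and of its products with
initial segments of `∏ (1 - y i X)` when `∏_{i<n} (1 - y i X) F = 1 + ζ X ^ r F`. -/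
structure ArgRecurrence (ζ : ℂ) (r n : ℕ) (y : ℕ → ℝ) (A : ℕ → ℂ) (G : ℕ → ℕ → ℂ) : Prop where
  zero : ∀ j < n, G j 0 = 1
  step : ∀ j < n, ∀ m, G j (m + 1) = y j * G j m + G (j + 1) (m + 1)
  last : ∀ m, G n (m + 1) = ζ * A (m + 1)
  shift : ∀ m, A (m + r) = G 0 m
  low : ∀ k < r, A k = 0

namespace ArgRecurrence

variable {ζ : ℂ} {r n : ℕ} {y : ℕ → ℝ} {A : ℕ → ℂ} {G : ℕ → ℕ → ℂ}

/-- The window in transit from `m` to `m + 1`: `ζ * A (m + 1) = G n (m + 1)` has been appended, and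
the last `j` entries have been updated from right to left, each using its already updated right
neighbour. -/
theorem pairwise_mixed (h : ArgRecurrence ζ r n y A G) (hζ : 0 < ζ.im) (hr : 1 ≤ r)
    (hy : ∀ i, 0 < y i) {m : ℕ} (hm : (argWindow A G r n m).Pairwise (ArgOrdered ζ))
    (j : ℕ) : j ≤ n → ((List.range' (m + 2) (r - 1)).map A ++ ((List.range' 0 (n - j)).map (G · m) ++
      (List.range' (n - j) (j + 1)).map (G · (m + 1)))).Pairwise (ArgOrdered ζ) := by
  induction j with
  | zero =>
    intro _
    obtain ⟨r, rfl⟩ : ∃ k, r = k + 1 := ⟨r - 1, by omega⟩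
    simp only [argWindow, List.range'_succ, List.map_cons, List.cons_append,
      List.pairwise_cons] at hm
    have e : [ζ * A (m + 1)] = (List.range' n 1).map (G · (m + 1)) := by
      simp [h.last]
    rw [Nat.sub_zero, ← e, ← List.append_assoc, List.pairwise_append]
    refine ⟨hm.2, List.pairwise_singleton _ _, ?_⟩
    intro a ha b hb
    rw [List.mem_singleton] at hb
    subst hb
    exact (hm.1 a ha).mul_left
  | succ j ih =>
    intro hj
    have ih := ih (by omega)
    obtain ⟨k, hk⟩ : ∃ k, n - j = k + 1 := ⟨n - j - 1, by omega⟩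
    have hk' : n - (j + 1) = k := by omega
    rw [hk']
    rw [hk, List.range'_concat, List.range'_succ] at ih
    simp only [List.map_append, List.map_cons, List.map_nil, Nat.zero_add, one_mul,
      List.append_assoc, List.cons_append, List.nil_append] at ih
    rw [← List.append_assoc] at ih
    have := pairwise_insert_comb hζ (hy k).le ih
    rw [← h.step k (by omega)] at this
    rw [List.range'_succ, List.range'_succ]
    simpa using this

theorem pairwise_window (h : ArgRecurrence ζ r n y A G) (hζ : 0 < ζ.im) (hr : 1 ≤ r) (hn : 1 ≤ n)
    (hy : ∀ i, 0 < y i) (m : ℕ) :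
    (argWindow A G r n m).Pairwise (ArgOrdered ζ) ∧ G 0 m ≠ 0 := by
  induction m with
  | zero =>
    refine ⟨?_, by rw [h.zero 0 (by omega)]; exact one_ne_zero⟩
    obtain ⟨r, rfl⟩ : ∃ k, r = k + 1 := ⟨r - 1, by omega⟩
    -- The initial window is `0, …, 0, 1, 1, …, 1`; zero is comparable with everything.
    have e1 : (List.range' (0 + 1) (r + 1)).map A = List.replicate r 0 ++ [1] := by
      have e3 : (List.range' (0 + 1) r).map A = List.replicate r 0 := by
        rw [List.eq_replicate_iff]
        refine ⟨by simp, ?_⟩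
        intro b hb
        simp only [List.mem_map, List.mem_range'_1] at hb
        obtain ⟨a, ha, rfl⟩ := hb
        exact h.low a (by omega)
      have := h.shift 0
      rw [zero_add, h.zero 0 (by omega)] at this
      rw [List.range'_concat, List.map_append, e3]
      simpa [add_comm] using this
    have e2 : (List.range' 0 n).map (G · 0) = List.replicate n 1 := by
      rw [List.eq_replicate_iff]
      refine ⟨by simp, ?_⟩
      intro b hb
      simp only [List.mem_map, List.mem_range'_1] at hb
      obtain ⟨a, ha, rfl⟩ := hb
      exact h.zero a (by omega)
    rw [argWindow, e1, e2]
    have h0 : ∀ b, ArgOrdered ζ 0 b := fun b => by simp [ArgOrdered]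
    simp only [List.pairwise_append, List.pairwise_replicate, List.mem_replicate,
      List.mem_append, List.mem_singleton, List.pairwise_singleton]
    refine ⟨⟨Or.inr (h0 0), trivial, ?_⟩, Or.inr (.refl hζ 1), ?_⟩
    · rintro a ⟨-, rfl⟩ b -
      exact h0 b
    · rintro a (⟨-, rfl⟩ | rfl) b ⟨-, rfl⟩
      · exact h0 1
      · exact .refl hζ 1
  | succ m ih =>
    obtain ⟨ih, ih0⟩ := ih
    constructor
    · have h1 := h.pairwise_mixed hζ hr hy ih n le_rfl
      obtain ⟨r, rfl⟩ : ∃ k, r = k + 1 := ⟨r - 1, by omega⟩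
      have e1 : (List.range' (m + 1 + 1) (r + 1)).map A
          = (List.range' (m + 2) r).map A ++ [G 0 (m + 1)] := by
        rw [List.range'_concat, List.map_append, ← h.shift]
        simp; ring_nf
      rw [argWindow, e1]
      obtain ⟨n, rfl⟩ : ∃ k, n = k + 1 := ⟨n - 1, by omega⟩
      rw [Nat.sub_self, List.range'_concat (n := n + 1), List.map_append, ← List.append_assoc,
        List.range'_zero, List.map_nil, List.append_nil, ← List.append_assoc] at h1
      have h1 := (List.pairwise_append.mp h1).1
      rw [List.range'_succ, List.map_cons, Nat.add_sub_cancel] at h1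
      rw [List.range'_succ, List.map_cons, List.append_assoc, List.singleton_append]
      simp only [List.pairwise_append, List.pairwise_cons, List.mem_cons] at h1 ⊢
      refine ⟨h1.1, ⟨?_, h1.2.1⟩, ?_⟩
      · rintro a (rfl | ha)
        · exact .refl hζ _
        · exact h1.2.1.1 a ha
      · rintro a ha b (rfl | hb)
        · exact h1.2.2 a ha _ (Or.inl rfl)
        · exact h1.2.2 a ha _ hb
    -- One update before the end, `G 0 m` and `G 1 (m + 1)` stand side by side, and `G 0 (m + 1)` is
    -- their positive combination.
    · have h1 := h.pairwise_mixed hζ hr hy ih (n - 1) (by omega)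
      rw [show n - (n - 1) = 1 by omega, List.range'_succ (n := n - 1)] at h1
      have h1 := (List.pairwise_append.mp h1).2.1
      simp only [List.range'_one, List.map_cons, List.map_nil, List.cons_append, List.nil_append,
        List.pairwise_cons, List.mem_cons] at h1
      rw [h.step 0 (by omega)]
      exact (h1.1 _ (Or.inl rfl)).add_ne_zero hζ ih0 (hy 0)

theorem not_sign_pattern_column (h : ArgRecurrence ζ r n y A G) (hζ : 0 < ζ.im) (hr : 1 ≤ r)
    (hn : 3 ≤ n) (hy : ∀ i, 0 < y i) (m : ℕ) (σ : ℝ) (h0 : 0 < (σ * G 0 m).re)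
    (h1 : (σ * G 1 m).re < 0) (h2 : 0 < (σ * G 2 m).re) : False := by
  have hp := (h.pairwise_window hζ hr (by omega) hy m).1
  obtain ⟨k, rfl⟩ : ∃ k, n = k + 3 := ⟨n - 3, by omega⟩
  have hp := (List.pairwise_append.mp hp).2.1
  simp only [List.range'_succ, List.map_cons, List.pairwise_cons, List.mem_cons] at hp
  exact ArgOrdered.not_sign_pattern hζ ((hp.1 _ (Or.inl rfl)).smul_real σ)
    ((hp.2.1 _ (Or.inl rfl)).smul_real σ) ((hp.1 _ (Or.inr (Or.inl rfl))).smul_real σ) h0 h1 h2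

/-- The `A` part of a window consists of `r` consecutive coefficients of `F`, so three of them fit
when `r ≥ 3`. -/
theorem not_sign_pattern_row (h : ArgRecurrence ζ r n y A G) (hζ : 0 < ζ.im) (hr : 3 ≤ r)
    (hn : 1 ≤ n) (hy : ∀ i, 0 < y i) (m : ℕ) (σ : ℝ) (h0 : 0 < (σ * G 0 m).re)
    (h1 : (σ * G 0 (m + 1)).re < 0) (h2 : 0 < (σ * G 0 (m + 2)).re) : False := by
  have hp := (h.pairwise_window hζ (by omega) hn hy (m + (r - 1))).1
  rw [← h.shift] at h0 h1 h2
  obtain ⟨k, rfl⟩ : ∃ k, r = k + 3 := ⟨r - 3, by omega⟩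
  have hp := (List.pairwise_append.mp hp).1
  simp only [List.range'_succ, List.map_cons, List.pairwise_cons, List.mem_cons] at hp
  have e0 : m + (k + 3 - 1) + 1 = m + (k + 3) := by omega
  have e1 : m + (k + 3) + 1 = m + 1 + (k + 3) := by omega
  have e2 : m + 1 + (k + 3) + 1 = m + 2 + (k + 3) := by omega
  rw [e0, e1, e2] at hp
  exact ArgOrdered.not_sign_pattern hζ ((hp.1 _ (Or.inl rfl)).smul_real σ)
    ((hp.2.1 _ (Or.inl rfl)).smul_real σ) ((hp.1 _ (Or.inr (Or.inl rfl))).smul_real σ) h0 h1 h2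

end ArgRecurrence

/-! ### Factorization of `P` and the generating series. -/

/-- The polynomial `∏_{i < n} (1 - y i X)`. -/
noncomputable def linProd (y : ℕ → ℝ) (n : ℕ) : ℝ[X] :=
  ∏ i ∈ Finset.range n, (1 - C (y i) * X)

theorem linProd_zero (y : ℕ → ℝ) : linProd y 0 = 1 :=
  Finset.prod_range_zero _

theorem linProd_succ (y : ℕ → ℝ) (n : ℕ) :
    linProd y (n + 1) = linProd y n * (1 - C (y n) * X) :=
  Finset.prod_range_succ _ _

theorem linProd_succ' (y : ℕ → ℝ) (n : ℕ) :
    linProd y (n + 1) = linProd (fun i => y (i + 1)) n * (1 - C (y 0) * X) :=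
  Finset.prod_range_succ' _ _

theorem eval_linProd (y : ℕ → ℝ) (n : ℕ) (t : ℝ) :
    (linProd y n).eval t = ∏ i ∈ Finset.range n, (1 - y i * t) := by
  simp [linProd, eval_prod]

theorem linProd_eval_zero (y : ℕ → ℝ) (n : ℕ) : (linProd y n).eval 0 = 1 := by
  simp [eval_linProd]

theorem exists_list_factorization (N : ℕ) : ∀ P : ℝ[X], P.natDegree = N →
    (∀ t : ℂ, aeval t P = 0 → ∃ x : ℝ, 0 < x ∧ t = (x : ℂ)) →
    ∃ l : List ℝ, (∀ a ∈ l, 0 < a) ∧ l.length = N ∧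
      P = C (P.eval 0) * (l.map fun a => 1 - C a * X).prod := by
  induction N with
  | zero =>
    intro P hN _
    refine ⟨[], by simp, rfl, ?_⟩
    rw [eq_C_of_natDegree_eq_zero hN]
    simp
  | succ N ih =>
    intro P hN hz
    have hdeg : 0 < (P.map (algebraMap ℝ ℂ)).degree := by
      rw [degree_map]
      exact natDegree_pos_iff_degree_pos.mp (by omega)
    obtain ⟨t, ht⟩ := Complex.exists_root hdeg
    rw [IsRoot.def, eval_map_algebraMap] at ht
    obtain ⟨x, hx, rfl⟩ := hz t ht
    have hx0 : P.IsRoot x := by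
      have := Polynomial.aeval_algebraMap_apply ℂ x P
      rw [Complex.coe_algebraMap, ht] at this
      rw [IsRoot.def, ← Polynomial.coe_aeval_eq_eval]
      exact_mod_cast this.symm
    obtain ⟨Q, rfl⟩ := dvd_iff_isRoot.mpr hx0
    have hP0 : (X - C x) * Q ≠ 0 := by
      intro h
      rw [h] at hN
      simp at hN
    have hQN : Q.natDegree = N := by
      rw [natDegree_mul (left_ne_zero_of_mul hP0) (right_ne_zero_of_mul hP0),
        natDegree_X_sub_C] at hN
      omega
    obtain ⟨l, hl, hlen, hQ⟩ := ih Q hQN fun t ht => hz t (by simp [ht])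
    refine ⟨x⁻¹ :: l, ?_, by simp [hlen], ?_⟩
    · rintro a ha
      rcases List.mem_cons.mp ha with rfl | ha
      · positivity
      · exact hl a ha
    · have h1 : (X - C x : ℝ[X]) = C (-x) * (1 - C x⁻¹ * X) := by
        rw [mul_sub, ← mul_assoc, ← C_mul]
        simp [hx.ne']
        ring
      conv_lhs => rw [hQ, h1]
      simp
      ring

theorem exists_factorization {P : ℝ[X]}
    (hz : ∀ t : ℂ, aeval t P = 0 → ∃ x : ℝ, 0 < x ∧ t = (x : ℂ)) :
    ∃ y : ℕ → ℝ, (∀ i, 0 < y i) ∧ (∀ i j, i ≤ j → j < P.natDegree → y j ≤ y i) ∧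
      P = C (P.eval 0) * linProd y P.natDegree := by
  obtain ⟨l, hl, hlen, hP⟩ := exists_list_factorization _ P rfl hz
  set l' := l.mergeSort (fun a b => decide (b ≤ a)) with hl'
  have hperm : l'.Perm l := List.mergeSort_perm _ _
  have hsort : l'.Pairwise (fun a b => b ≤ a) := by
    have := List.pairwise_mergeSort (le := fun a b : ℝ => decide (b ≤ a))
      (by simpa using fun a b c h1 h2 => h2.trans h1)
      (by simpa using fun a b => le_total b a) l
    simpa using this
  have hlen' : l'.length = P.natDegree := by rw [hperm.length_eq, hlen]
  -- The default `1` keeps `y i` positive beyond the degree; only indices below it matter for the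
  -- product.
  refine ⟨fun i => l'.getD i 1, ?_, ?_, ?_⟩
  · intro i
    rcases lt_or_ge i l'.length with h | h
    · simp only [List.getD_eq_getElem _ _ h]
      exact hl _ (hperm.mem_iff.mp (List.getElem_mem h))
    · simp [List.getElem?_eq_none h]
  · intro i j hij hj
    have hj' : j < l'.length := by omega
    have hi' : i < l'.length := by omega
    simp only [List.getD_eq_getElem _ _ hj', List.getD_eq_getElem _ _ hi']
    rcases hij.eq_or_lt with rfl | hij
    · rfl
    · exact List.pairwise_iff_getElem.mp hsort i j hi' hj' hij
  · conv_lhs => rw [hP]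
    congr 1
    rw [← (hperm.map _).prod_eq, linProd, Finset.prod_range, ← hlen', ← List.prod_ofFn]
    congr 1
    apply List.ext_getElem (by simp)
    intro i h1 h2
    simp at h1
    simp

theorem genSeries_spec {P : ℝ[X]} {r : ℕ} (hr : 1 ≤ r) (hP : P.eval 0 ≠ 0) {A : Type*}
    [CommRing A] [Algebra ℝ A] (z : A) :
    (((P.map (algebraMap ℝ A) : A[X]) : PowerSeries A) + PowerSeries.C z * PowerSeries.X ^ r) *
      PowerSeries.mk (fun m => aeval z (genPoly P r m)) = 1 := by
  have h := congrArg (PowerSeries.map (aeval z : ℝ[X] →ₐ[ℝ] A).toRingHom) (genPoly_spec P r hr hP)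
  rw [map_mul, map_one, genDenom, map_add, map_mul, map_pow, PowerSeries.map_C,
    PowerSeries.map_X, ← Polynomial.polynomial_map_coe, Polynomial.map_map] at h
  have e1 : ((aeval z : ℝ[X] →ₐ[ℝ] A).toRingHom.comp C) = algebraMap ℝ A := by
    ext x
    simp
  have e2 : PowerSeries.map (aeval z : ℝ[X] →ₐ[ℝ] A).toRingHom (PowerSeries.mk (genPoly P r))
      = PowerSeries.mk (fun m => aeval z (genPoly P r m)) := by
    ext m
    simp
  rw [e1, e2] at h
  simpa using h

/-- The series `p₀ / (p₀ ∏ (1 - y i X) + z X ^ r)` satisfies `∏ (1 - y i X) F = 1 + ζ X ^ r F`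
with `ζ = -z / p₀`. -/
theorem linProd_mul_genSeries {p₀ : ℝ} (hp : p₀ ≠ 0) {y : ℕ → ℝ} {n r : ℕ} (hr : 1 ≤ r)
    {A : Type*} [CommRing A] [Algebra ℝ A] (z : A) :
    (((linProd y n).map (algebraMap ℝ A) : A[X]) : PowerSeries A) *
      PowerSeries.mk (fun m => algebraMap ℝ A p₀ * aeval z (genPoly (C p₀ * linProd y n) r m))
    = 1 + PowerSeries.C (-(algebraMap ℝ A p₀⁻¹ * z)) * (PowerSeries.X ^ r *
      PowerSeries.mk (fun m => algebraMap ℝ A p₀ *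
        aeval z (genPoly (C p₀ * linProd y n) r m))) := by
  have h := genSeries_spec (P := C p₀ * linProd y n) hr (by simpa [linProd_eval_zero]) z
  set f := PowerSeries.mk (fun m => aeval z (genPoly (C p₀ * linProd y n) r m)) with hf
  have e : PowerSeries.mk (fun m => algebraMap ℝ A p₀ *
      aeval z (genPoly (C p₀ * linProd y n) r m)) = PowerSeries.C (algebraMap ℝ A p₀) * f := by
    ext m
    simp [hf]
  rw [e]
  have e2 : PowerSeries.C (algebraMap ℝ A p₀⁻¹) * PowerSeries.C (algebraMap ℝ A p₀) = 1 := by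
    rw [← map_mul, ← map_mul, inv_mul_cancel₀ hp, map_one, map_one]
  rw [Polynomial.map_mul, Polynomial.map_C, Polynomial.coe_mul, Polynomial.coe_C] at h
  rw [map_neg, map_mul]
  linear_combination h + PowerSeries.C z * PowerSeries.X ^ r * f * e2

theorem argRecurrence_of_series {ζ : ℂ} {r n : ℕ} {y : ℕ → ℝ} {F : PowerSeries ℂ} (hr : 1 ≤ r)
    (hF : (((linProd y n).map (algebraMap ℝ ℂ) : ℂ[X]) : PowerSeries ℂ) * F
      = 1 + PowerSeries.C ζ * (PowerSeries.X ^ r * F)) :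
    ArgRecurrence ζ r n y (fun k => PowerSeries.coeff k (PowerSeries.X ^ r * F))
      (fun j m => PowerSeries.coeff m
        ((((linProd y j).map (algebraMap ℝ ℂ) : ℂ[X]) : PowerSeries ℂ) * F)) where
  zero j _ := by
    have hc (k : ℕ) : PowerSeries.constantCoeff
        (((linProd y k).map (algebraMap ℝ ℂ) : ℂ[X]) : PowerSeries ℂ) = 1 := by
      rw [Polynomial.constantCoeff_coe, coeff_map, coeff_zero_eq_eval_zero, linProd_eval_zero,
        map_one]
    have h0 := congrArg PowerSeries.constantCoeff hF
    have hr' : r ≠ 0 := by omega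
    rw [map_mul, hc] at h0
    simp [hr'] at h0
    rw [PowerSeries.coeff_zero_eq_constantCoeff_apply, map_mul, hc]
    simp [h0]
  step j _ m := by
    simp only [linProd_succ, Polynomial.map_mul, Polynomial.coe_mul]
    have e : ((((1 - C (y j) * X : ℝ[X]).map (algebraMap ℝ ℂ) : ℂ[X])) : PowerSeries ℂ)
        = 1 - PowerSeries.C (y j : ℂ) * PowerSeries.X := by
      simp [Polynomial.map_sub]
    rw [e, mul_assoc, mul_comm (1 - _), ← mul_assoc, mul_sub, mul_one, map_sub,
      mul_comm (PowerSeries.C (y j : ℂ)), ← mul_assoc, PowerSeries.coeff_mul_C,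
      PowerSeries.coeff_succ_mul_X]
    ring
  last m := by
    rw [hF]
    simp [PowerSeries.coeff_one]
  shift m := by
    simp [PowerSeries.coeff_X_pow_mul, linProd]
  low k hk := by
    rw [PowerSeries.coeff_X_pow_mul', if_neg (by omega)]

theorem aeval_genPoly_ne_zero_of_im_ne_zero {p₀ : ℝ} (hp : 0 < p₀) {y : ℕ → ℝ}
    (hy : ∀ i, 0 < y i) {n r : ℕ} (hr : 1 ≤ r) (hn : 1 ≤ n) {z : ℂ} (hz : z.im ≠ 0) (m : ℕ) :
    aeval z (genPoly (C p₀ * linProd y n) r m) ≠ 0 := by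
  -- The lower half-plane for `z` is the upper one for `ζ = -z / p₀`; conjugation covers the other
  -- half.
  have key : ∀ z : ℂ, z.im < 0 → aeval z (genPoly (C p₀ * linProd y n) r m) ≠ 0 := by
    intro z hz h0
    have hζ : 0 < (-(algebraMap ℝ ℂ p₀⁻¹ * z)).im := by
      rw [Complex.coe_algebraMap, Complex.neg_im, Complex.im_ofReal_mul]
      have := mul_neg_of_pos_of_neg (inv_pos.mpr hp) hz
      linarith
    have h := (argRecurrence_of_series hr
      (linProd_mul_genSeries hp.ne' (y := y) (n := n) hr z)).pairwise_window hζ hr hn hy m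
    apply h.2
    simp [linProd_zero, h0]
  rcases lt_or_gt_of_ne hz with h | h
  · exact key z h
  · intro h0
    apply key (starRingEnd ℂ z) (by simpa using h)
    rw [Polynomial.aeval_conj, h0, map_zero]

/-- The real power series `p₀ / (p₀ ∏ (1 - y i X) + x X ^ r)`. -/
noncomputable def genSeries (p₀ : ℝ) (y : ℕ → ℝ) (n r : ℕ) (x : ℝ) : PowerSeries ℝ :=
  PowerSeries.mk fun m => p₀ * (genPoly (C p₀ * linProd y n) r m).eval x

theorem linProd_mul_genSeries_real {p₀ : ℝ} (hp : p₀ ≠ 0) {y : ℕ → ℝ} {n r : ℕ} (hr : 1 ≤ r)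
    (x : ℝ) :
    (linProd y n : PowerSeries ℝ) * genSeries p₀ y n r x
      = 1 + PowerSeries.C (-(p₀⁻¹ * x)) * (PowerSeries.X ^ r * genSeries p₀ y n r x) := by
  simpa [genSeries] using linProd_mul_genSeries hp (y := y) (n := n) hr (A := ℝ) x

/-! ### Sign patterns excluded at real parameters. -/

section Limit

open Filter Topology

theorem tendsto_coeff_genSeries (p₀ : ℝ) (y : ℕ → ℝ) (n r : ℕ) (x : ℝ) (j m : ℕ) :
    Tendsto (fun ε : ℝ => PowerSeries.coeff m
      ((((linProd y j).map (algebraMap ℝ ℂ) : ℂ[X]) : PowerSeries ℂ) *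
        PowerSeries.mk (fun k => algebraMap ℝ ℂ p₀ *
          aeval ((x : ℂ) - ε * Complex.I) (genPoly (C p₀ * linProd y n) r k)))) (𝓝[>] 0)
      (𝓝 ((PowerSeries.coeff m ((linProd y j : PowerSeries ℝ) * genSeries p₀ y n r x) : ℝ) : ℂ)) := by
  apply tendsto_nhdsWithin_of_tendsto_nhds
  have hc : Continuous (fun ε : ℝ => PowerSeries.coeff m
      ((((linProd y j).map (algebraMap ℝ ℂ) : ℂ[X]) : PowerSeries ℂ) *
        PowerSeries.mk (fun k => algebraMap ℝ ℂ p₀ *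
          aeval ((x : ℂ) - ε * Complex.I) (genPoly (C p₀ * linProd y n) r k)))) := by
    simp only [PowerSeries.coeff_mul, PowerSeries.coeff_mk]
    fun_prop
  have h0 := hc.tendsto 0
  convert h0 using 2
  simp only [genSeries, PowerSeries.coeff_mul, PowerSeries.coeff_mk, Polynomial.coeff_coe,
    coeff_map, Complex.coe_algebraMap, Complex.ofReal_zero, zero_mul, sub_zero,
    Complex.ofReal_sum, Complex.ofReal_mul]
  refine Finset.sum_congr rfl fun k _ => ?_
  rw [← Complex.coe_algebraMap, Polynomial.aeval_algebraMap_apply, Polynomial.coe_aeval_eq_eval]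

variable {p₀ : ℝ} {y : ℕ → ℝ} {n r : ℕ}

/-- Strict signs at `x` persist at `x - ε i` for small `ε > 0`, where `Im ζ > 0` and the argument
ordering is available. -/
theorem eventually_signs (hp : 0 < p₀) (hr : 1 ≤ r) (x σ : ℝ) {j₀ j₁ j₂ m₀ m₁ m₂ : ℕ}
    (h0 : 0 < σ * PowerSeries.coeff m₀ ((linProd y j₀ : PowerSeries ℝ) * genSeries p₀ y n r x))
    (h1 : σ * PowerSeries.coeff m₁ ((linProd y j₁ : PowerSeries ℝ) * genSeries p₀ y n r x) < 0)
    (h2 : 0 < σ * PowerSeries.coeff m₂ ((linProd y j₂ : PowerSeries ℝ) * genSeries p₀ y n r x)) :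
    ∃ (ζ : ℂ) (A : ℕ → ℂ) (G : ℕ → ℕ → ℂ), 0 < ζ.im ∧ ArgRecurrence ζ r n y A G ∧
      0 < (σ * G j₀ m₀).re ∧ (σ * G j₁ m₁).re < 0 ∧ 0 < (σ * G j₂ m₂).re := by
  have key (j m : ℕ) := Complex.continuous_re.continuousAt.tendsto.comp
    ((tendsto_coeff_genSeries p₀ y n r x j m).const_mul (σ : ℂ))
  have e (j m : ℕ) : ((σ : ℂ) * (((PowerSeries.coeff m
      ((linProd y j : PowerSeries ℝ) * genSeries p₀ y n r x) : ℝ) : ℂ))).re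
      = σ * PowerSeries.coeff m ((linProd y j : PowerSeries ℝ) * genSeries p₀ y n r x) := by
    simp
  simp only [e] at key
  obtain ⟨ε, ⟨⟨hε0, hε1⟩, hε2⟩, hε⟩ := ((((key j₀ m₀).eventually_const_lt h0).and
    ((key j₁ m₁).eventually_lt_const h1)).and ((key j₂ m₂).eventually_const_lt h2)).and
    self_mem_nhdsWithin |>.exists
  refine ⟨_, _, _, ?_, argRecurrence_of_series hr
    (linProd_mul_genSeries hp.ne' (y := y) (n := n) hr ((x : ℂ) - ε * Complex.I)), hε0, hε1, hε2⟩
  have hε : 0 < ε := hε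
  simp
  positivity

theorem genSeries_not_sign_pattern_column (hp : 0 < p₀) (hr : 1 ≤ r) (hn : 3 ≤ n)
    (hy : ∀ i, 0 < y i) (x σ : ℝ) (m : ℕ)
    (h0 : 0 < σ * PowerSeries.coeff m ((linProd y 0 : PowerSeries ℝ) * genSeries p₀ y n r x))
    (h1 : σ * PowerSeries.coeff m ((linProd y 1 : PowerSeries ℝ) * genSeries p₀ y n r x) < 0)
    (h2 : 0 < σ * PowerSeries.coeff m ((linProd y 2 : PowerSeries ℝ) * genSeries p₀ y n r x)) :
    False := by
  obtain ⟨ζ, A, G, hζ, h, h0, h1, h2⟩ := eventually_signs hp hr x σ h0 h1 h2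
  exact h.not_sign_pattern_column hζ hr hn hy m σ h0 h1 h2

theorem genSeries_not_sign_pattern_row (hp : 0 < p₀) (hr : 3 ≤ r) (hn : 1 ≤ n)
    (hy : ∀ i, 0 < y i) (x σ : ℝ) (m : ℕ)
    (h0 : 0 < σ * PowerSeries.coeff m (genSeries p₀ y n r x))
    (h1 : σ * PowerSeries.coeff (m + 1) (genSeries p₀ y n r x) < 0)
    (h2 : 0 < σ * PowerSeries.coeff (m + 2) (genSeries p₀ y n r x)) : False := by
  have e : genSeries p₀ y n r x = (linProd y 0 : PowerSeries ℝ) * genSeries p₀ y n r x := by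
    simp [linProd_zero]
  rw [e] at h0 h1 h2
  obtain ⟨ζ, A, G, hζ, h, h0, h1, h2⟩ := eventually_signs hp (by omega) x σ h0 h1 h2
  exact h.not_sign_pattern_row hζ hr hn hy m σ h0 h1 h2

end Limit

/-! ### Absolutely convergent evaluation of power series. -/

section AbsEval

variable {𝕜 : Type*} [NormedField 𝕜]

/-- The power series `f` converges absolutely at `t`, with sum `v`. -/
def AbsEval (f : PowerSeries 𝕜) (t v : 𝕜) : Prop :=
  Summable (fun m => ‖PowerSeries.coeff m f * t ^ m‖) ∧
    HasSum (fun m => PowerSeries.coeff m f * t ^ m) v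

theorem absEval_coe (p : 𝕜[X]) (t : 𝕜) : AbsEval (p : PowerSeries 𝕜) t (p.eval t) := by
  have h : ∀ m ∉ p.support, PowerSeries.coeff m (p : PowerSeries 𝕜) * t ^ m = 0 := by
    intro m hm
    rw [Polynomial.coeff_coe, notMem_support_iff.mp hm, zero_mul]
  constructor
  · apply summable_of_ne_finset_zero (s := p.support)
    intro m hm
    rw [h m hm, norm_zero]
  · have := hasSum_sum_of_ne_finset_zero (L := SummationFilter.unconditional ℕ) h
    rw [eval_eq_sum, Polynomial.sum]
    simpa using this

theorem AbsEval.mul [CompleteSpace 𝕜] {f g : PowerSeries 𝕜} {t v w : 𝕜} (hf : AbsEval f t v) (hg : AbsEval g t w) :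
    AbsEval (f * g) t (v * w) := by
  have e : (fun m => PowerSeries.coeff m (f * g) * t ^ m) = fun m =>
      ∑ kl ∈ Finset.HasAntidiagonal.antidiagonal m, (PowerSeries.coeff kl.1 f * t ^ kl.1) *
        (PowerSeries.coeff kl.2 g * t ^ kl.2) := by
    funext m
    rw [PowerSeries.coeff_mul, Finset.sum_mul]
    refine Finset.sum_congr rfl fun kl hkl => ?_
    rw [← Finset.HasAntidiagonal.mem_antidiagonal.mp hkl, pow_add]
    ring
  have hs : Summable (fun m => ‖PowerSeries.coeff m (f * g) * t ^ m‖) := by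
    have := summable_norm_sum_mul_antidiagonal_of_summable_norm hf.1 hg.1
    simpa only [congrFun e] using this
  refine ⟨hs, ?_⟩
  have := tsum_mul_tsum_eq_tsum_sum_antidiagonal_of_summable_norm hf.1 hg.1
  rw [← e, hf.2.tsum_eq, hg.2.tsum_eq] at this
  rw [this]
  exact hs.of_norm.hasSum

theorem absEval_geom {a t : 𝕜} (h : ‖a * t‖ < 1) :
    AbsEval (PowerSeries.mk (fun m => a ^ m)) t (1 - a * t)⁻¹ := by
  constructor
  · simpa [← mul_pow] using summable_geometric_of_lt_one (norm_nonneg _) h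
  · simpa [← mul_pow] using hasSum_geometric_of_norm_lt_one h

end AbsEval

/-! ### Signs of the coefficients outside `(a, b)`. -/

theorem one_sub_mul_geom {A : Type*} [CommRing A] (a : A) :
    (((1 - C a * X : A[X])) : PowerSeries A) * PowerSeries.mk (fun m => a ^ m) = 1 := by
  ext m
  rw [Polynomial.coe_sub, Polynomial.coe_mul, sub_mul, map_sub]
  cases m with
  | zero => simp
  | succ m =>
    simp [mul_assoc, PowerSeries.coeff_succ_X_mul, PowerSeries.coeff_one, pow_succ']

/-- The power series `1 / ∏_{i < n} (1 - y i X)`. -/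
noncomputable def linProdInv (y : ℕ → ℝ) (n : ℕ) : PowerSeries ℝ :=
  ∏ i ∈ Finset.range n, PowerSeries.mk fun m => y i ^ m

theorem linProd_mul_inv (y : ℕ → ℝ) (n : ℕ) :
    (linProd y n : PowerSeries ℝ) * linProdInv y n = 1 := by
  induction n with
  | zero => simp [linProd, linProdInv]
  | succ n ih =>
    rw [linProd_succ, linProdInv, Finset.prod_range_succ, ← linProdInv, Polynomial.coe_mul]
    linear_combination ih + (linProd y n : PowerSeries ℝ) * linProdInv y n *
      one_sub_mul_geom (y n)

theorem linProdInv_coeff_zero (y : ℕ → ℝ) (n : ℕ) :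
    PowerSeries.coeff 0 (linProdInv y n) = 1 := by
  simp [linProdInv, map_prod]

theorem linProdInv_coeff_nonneg {y : ℕ → ℝ} (hy : ∀ i, 0 < y i) (n m : ℕ) :
    0 ≤ PowerSeries.coeff m (linProdInv y n) := by
  induction n generalizing m with
  | zero =>
    simp only [linProdInv, Finset.prod_range_zero, PowerSeries.coeff_one]
    split_ifs <;> simp
  | succ n ih =>
    rw [linProdInv, Finset.prod_range_succ, ← linProdInv, PowerSeries.coeff_mul]
    refine Finset.sum_nonneg fun kl _ => mul_nonneg (ih _) ?_
    simpa using pow_nonneg (hy n).le _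

theorem linProdInv_coeff_pos {y : ℕ → ℝ} (hy : ∀ i, 0 < y i) {n : ℕ} (hn : 1 ≤ n) (m : ℕ) :
    0 < PowerSeries.coeff m (linProdInv y n) := by
  obtain ⟨n, rfl⟩ : ∃ k, n = k + 1 := ⟨n - 1, by omega⟩
  rw [linProdInv, Finset.prod_range_succ, ← linProdInv, PowerSeries.coeff_mul]
  refine Finset.sum_pos' (fun kl _ => mul_nonneg (linProdInv_coeff_nonneg hy _ _) ?_)
    ⟨(0, m), by simp, ?_⟩
  · simpa using pow_nonneg (hy n).le _
  · rw [linProdInv_coeff_zero]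
    simpa using pow_pos (hy n) _

theorem linProdInv_absEval {y : ℕ → ℝ} (n : ℕ) {t : ℝ} (h : ∀ i < n, |y i * t| < 1) :
    AbsEval (linProdInv y n) t ((linProd y n).eval t)⁻¹ := by
  induction n with
  | zero =>
    have := absEval_coe (1 : ℝ[X]) t
    rw [Polynomial.coe_one, eval_one] at this
    rwa [linProd_zero, eval_one, inv_one, linProdInv, Finset.prod_range_zero]
  | succ n ih =>
    have h1 := (ih fun i hi => h i (by omega)).mul (absEval_geom (h n (by omega)))
    rw [linProd_succ, linProdInv, Finset.prod_range_succ, ← linProdInv]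
    rwa [eval_mul, mul_inv, show (1 - C (y n) * X : ℝ[X]).eval t = 1 - y n * t by simp]

/-- If `w (1 - y X + c) = 1` where `c` has nonnegative coefficients, no constant term, and
`c(T) ≤ y T - 1` for some `T > 0`, then `w` has positive coefficients. -/
theorem coeff_pos_of_mul_eq_one {w c : PowerSeries ℝ} {y T : ℝ} (hT : 0 < T)
    (hw : w * (1 - PowerSeries.C y * PowerSeries.X + c) = 1) (hc0 : PowerSeries.coeff 0 c = 0)
    (hc : ∀ j, 0 ≤ PowerSeries.coeff j c)
    (hsum : ∀ N, ∑ j ∈ Finset.range N, PowerSeries.coeff j c * T ^ j ≤ y * T - 1) (m : ℕ) :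
    0 < PowerSeries.coeff m w := by
  have h0 : PowerSeries.coeff 0 w = 1 := by
    have := congrArg PowerSeries.constantCoeff hw
    rw [PowerSeries.coeff_zero_eq_constantCoeff_apply] at hc0 ⊢
    simpa [hc0] using this
  have hrec (m : ℕ) : PowerSeries.coeff (m + 1) w = y * PowerSeries.coeff m w -
      ∑ j ∈ Finset.range (m + 1), PowerSeries.coeff (j + 1) c * PowerSeries.coeff (m - j) w := by
    have := congrArg (PowerSeries.coeff (m + 1)) hw
    rw [show w * (1 - PowerSeries.C y * PowerSeries.X + c)
        = w - PowerSeries.C y * (PowerSeries.X * w) + c * w by ring, map_add, map_sub,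
      PowerSeries.coeff_C_mul, PowerSeries.coeff_succ_X_mul, PowerSeries.coeff_mul,
      Finset.Nat.sum_antidiagonal_eq_sum_range_succ_mk, Finset.sum_range_succ', hc0,
      PowerSeries.coeff_one, if_neg (by omega)] at this
    simp only [Nat.add_sub_add_right, zero_mul, add_zero] at this
    linarith
  -- The strengthened claim is that `T ^ m w_m` is nondecreasing; this bounds the convolution in
  -- `hrec` by the partial sums of `c(T)`.
  suffices H : ∀ m, ∀ k ≤ m, 0 < PowerSeries.coeff k w ∧ ∀ j, j + k = m →
      PowerSeries.coeff k w ≤ T ^ j * PowerSeries.coeff m w from (H m m le_rfl).1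
  clear m
  intro m
  induction m with
  | zero =>
    intro k hk
    obtain rfl : k = 0 := by omega
    refine ⟨by simp [h0], ?_⟩
    intro j hj
    obtain rfl : j = 0 := by omega
    simp
  | succ m ih =>
    have hm : 0 < PowerSeries.coeff m w := (ih m le_rfl).1
    have hs := hsum (m + 2)
    rw [Finset.sum_range_succ', hc0, zero_mul, add_zero] at hs
    have h1 : T * ∑ j ∈ Finset.range (m + 1), PowerSeries.coeff (j + 1) c *
        PowerSeries.coeff (m - j) w ≤
        (∑ j ∈ Finset.range (m + 1), PowerSeries.coeff (j + 1) c * T ^ (j + 1)) *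
          PowerSeries.coeff m w := by
      rw [Finset.mul_sum, Finset.sum_mul]
      refine Finset.sum_le_sum fun j hj => ?_
      have hj : j ≤ m := by have := Finset.mem_range.mp hj; omega
      have := mul_le_mul_of_nonneg_left ((ih (m - j) (by omega)).2 j (by omega))
        (mul_nonneg hT.le (hc (j + 1)))
      calc _ = T * PowerSeries.coeff (j + 1) c * PowerSeries.coeff (m - j) w := by ring
        _ ≤ _ := this
        _ = _ := by ring
    have h2 : PowerSeries.coeff m w ≤ T * PowerSeries.coeff (m + 1) w := by
      rw [hrec m, mul_sub]
      nlinarith [mul_le_mul_of_nonneg_right hs hm.le]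
    have h3 : 0 < PowerSeries.coeff (m + 1) w := by
      by_contra h
      nlinarith
    intro k hk
    rcases hk.eq_or_lt with rfl | hk
    · refine ⟨h3, fun j hj => ?_⟩
      obtain rfl : j = 0 := by omega
      simp
    · refine ⟨(ih k (by omega)).1, fun j hj => ?_⟩
      obtain ⟨i, rfl⟩ : ∃ i, j = i + 1 := ⟨j - 1, by omega⟩
      calc _ ≤ T ^ i * PowerSeries.coeff m w := (ih k (by omega)).2 i (by omega)
        _ ≤ T ^ i * (T * PowerSeries.coeff (m + 1) w) := by gcongr
        _ = _ := by ring

theorem linProd_neg_coeff_nonneg {y : ℕ → ℝ} (hy : ∀ i, 0 < y i) (n m : ℕ) :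
    0 ≤ (linProd (fun i => -y i) n).coeff m := by
  induction n generalizing m with
  | zero =>
    rw [linProd_zero, coeff_one]
    split_ifs <;> simp
  | succ n ih =>
    rw [linProd_succ, mul_sub, mul_one, coeff_sub, mul_left_comm, coeff_C_mul]
    cases m with
    | zero => simpa using ih 0
    | succ m =>
      rw [coeff_mul_X]
      nlinarith [ih m, ih (m + 1), mul_nonneg (hy n).le (ih m)]

theorem rescale_linProd (y : ℕ → ℝ) (n : ℕ) :
    PowerSeries.rescale (-1 : ℝ) (linProd y n : PowerSeries ℝ)
      = (linProd (fun i => -y i) n : PowerSeries ℝ) := by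
  induction n with
  | zero => simp [linProd_zero]
  | succ n ih =>
    rw [linProd_succ, linProd_succ, Polynomial.coe_mul, map_mul, ih, Polynomial.coe_mul]
    congr 1
    ext m
    rcases m with _ | _ | m <;> simp [PowerSeries.coeff_rescale]

variable {p₀ : ℝ} {y : ℕ → ℝ} {n r : ℕ}

theorem coeff_genSeries (x : ℝ) (m : ℕ) : PowerSeries.coeff m (genSeries p₀ y n r x)
    = p₀ * (genPoly (C p₀ * linProd y n) r m).eval x := by
  rw [genSeries, PowerSeries.coeff_mk]

theorem coeff_mul_pos {f g : PowerSeries ℝ} (hf : ∀ m, 0 ≤ PowerSeries.coeff m f)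
    (hf0 : 0 < PowerSeries.coeff 0 f) (hg : ∀ m, 0 < PowerSeries.coeff m g) (m : ℕ) :
    0 < PowerSeries.coeff m (f * g) := by
  rw [PowerSeries.coeff_mul]
  exact Finset.sum_pos' (fun kl _ => mul_nonneg (hf _) (hg _).le)
    ⟨(0, m), by simp, mul_pos hf0 (hg m)⟩

/-- Dividing by `∏ (1 - y i X)`, whose inverse has positive coefficients, makes the recursion for
`F` one with nonnegative terms. -/
theorem genPoly_eval_pos_of_nonpos (hp : 0 < p₀) (hy : ∀ i, 0 < y i) (hr : 1 ≤ r) (hn : 1 ≤ n)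
    {x : ℝ} (hx : x ≤ 0) (m : ℕ) : 0 < (genPoly (C p₀ * linProd y n) r m).eval x := by
  suffices h : ∀ m, 0 < PowerSeries.coeff m (genSeries p₀ y n r x) by
    have := h m
    rw [coeff_genSeries] at this
    exact pos_of_mul_pos_right this hp.le
  set F := genSeries p₀ y n r x with hF
  have hζ : 0 ≤ -(p₀⁻¹ * x) := by
    have := mul_nonneg (inv_pos.mpr hp).le (neg_nonneg.mpr hx)
    linarith
  have e : F = linProdInv y n + PowerSeries.C (-(p₀⁻¹ * x)) *
      (PowerSeries.X ^ r * linProdInv y n * F) := by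
    have h1 := linProd_mul_genSeries_real hp.ne' (y := y) (n := n) hr x
    have h2 := linProd_mul_inv y n
    rw [← hF] at h1
    linear_combination linProdInv y n * h1 - F * h2
  intro m
  induction m using Nat.strong_induction_on with
  | _ m ih =>
    rw [e, map_add, PowerSeries.coeff_C_mul, PowerSeries.coeff_mul]
    refine add_pos_of_pos_of_nonneg (linProdInv_coeff_pos hy hn m) (mul_nonneg hζ ?_)
    refine Finset.sum_nonneg fun kl hkl => ?_
    have hkl := Finset.HasAntidiagonal.mem_antidiagonal.mp hkl
    rw [PowerSeries.coeff_X_pow_mul']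
    split_ifs with h
    · exact mul_nonneg (linProdInv_coeff_nonneg hy _ _) (ih _ (by omega)).le
    · simp

/-- Split off the factor with `y 0`. With `Q` the product of the others, `w = Q F` satisfies `w (1 -
y 0 X + c) = 1`, where `c = (x / p₀) X ^ r / Q` has nonnegative coefficients and `hD` says `c(T) ≤ y
0 T - 1`. So `w` has positive coefficients, and so has `F = w / Q`. -/
theorem genPoly_eval_pos_of_le (hp : 0 < p₀) (hy : ∀ i, 0 < y i) (hr : 1 ≤ r) (hn : 1 ≤ n)
    {x T : ℝ} (hx : 0 ≤ x) (hT : 0 < T) (hyT : ∀ i < n, 1 ≤ i → y i * T < 1)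
    (hD : p₀ * (linProd y n).eval T + x * T ^ r ≤ 0) (m : ℕ) :
    0 < (genPoly (C p₀ * linProd y n) r m).eval x := by
  suffices h : ∀ m, 0 < PowerSeries.coeff m (genSeries p₀ y n r x) by
    have := h m
    rw [coeff_genSeries] at this
    exact pos_of_mul_pos_right this hp.le
  obtain ⟨n, rfl⟩ : ∃ k, n = k + 1 := ⟨n - 1, by omega⟩
  set y' : ℕ → ℝ := fun i => y (i + 1) with hy'
  have hy'0 : ∀ i, 0 < y' i := fun i => hy _
  set F := genSeries p₀ y (n + 1) r x with hF
  have h1 := linProd_mul_genSeries_real hp.ne' (y := y) (n := n + 1) hr x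
  have h2 := linProd_mul_inv y' n
  rw [← hF, linProd_succ', ← hy'] at h1
  set c : PowerSeries ℝ := ((C (p₀⁻¹ * x) * X ^ r : ℝ[X]) : PowerSeries ℝ) * linProdInv y' n with hc
  have hceq : c = PowerSeries.C (p₀⁻¹ * x) * (PowerSeries.X ^ r * linProdInv y' n) := by
    rw [hc]
    simp [mul_assoc]
  have hxp : 0 ≤ p₀⁻¹ * x := mul_nonneg (inv_pos.mpr hp).le hx
  have hw : ((linProd y' n : PowerSeries ℝ) * F) *
      (1 - PowerSeries.C (y 0) * PowerSeries.X + c) = 1 := by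
    rw [hceq]
    have e : (((linProd y' n * (1 - C (y 0) * X) : ℝ[X])) : PowerSeries ℝ)
        = (linProd y' n : PowerSeries ℝ) * (1 - PowerSeries.C (y 0) * PowerSeries.X) := by
      simp
    rw [e, map_neg] at h1
    linear_combination h1 + F * PowerSeries.C (p₀⁻¹ * x) * PowerSeries.X ^ r * h2
  have hcn : ∀ j, 0 ≤ PowerSeries.coeff j c := by
    intro j
    rw [hceq, PowerSeries.coeff_C_mul, PowerSeries.coeff_X_pow_mul']
    refine mul_nonneg hxp ?_
    split_ifs
    · exact linProdInv_coeff_nonneg hy'0 _ _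
    · rfl
  have hc0 : PowerSeries.coeff 0 c = 0 := by
    rw [hceq, PowerSeries.coeff_C_mul, PowerSeries.coeff_X_pow_mul', if_neg (by omega), mul_zero]
  have hQ : 0 < (linProd y' n).eval T := by
    rw [eval_linProd]
    refine Finset.prod_pos fun i hi => ?_
    have := hyT (i + 1) (by have := Finset.mem_range.mp hi; omega) (by omega)
    simp only [hy']
    linarith
  have habs : AbsEval c T (p₀⁻¹ * x * T ^ r * ((linProd y' n).eval T)⁻¹) := by
    have h3 := (absEval_coe (C (p₀⁻¹ * x) * X ^ r : ℝ[X]) T).mul (linProdInv_absEval (y := y') n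
      (t := T) (fun i hi => by
        rw [abs_of_pos (mul_pos (hy'0 i) hT)]
        exact hyT (i + 1) (by omega) (by omega)))
    rw [hc]
    convert h3 using 2
    simp
  have hval : p₀⁻¹ * x * T ^ r * ((linProd y' n).eval T)⁻¹ ≤ y 0 * T - 1 := by
    rw [← div_eq_mul_inv, div_le_iff₀ hQ, inv_mul_eq_div, div_mul_eq_mul_div, div_le_iff₀ hp]
    rw [linProd_succ', ← hy', eval_mul] at hD
    simp only [eval_sub, eval_one, eval_mul, eval_C, eval_X] at hD
    linarith
  have hpos := coeff_pos_of_mul_eq_one hT hw hc0 hcn (fun N =>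
    (sum_le_hasSum _ (fun j _ => mul_nonneg (hcn j) (pow_nonneg hT.le j)) habs.2).trans hval)
  have eF : F = linProdInv y' n * ((linProd y' n : PowerSeries ℝ) * F) := by
    linear_combination -F * h2
  rw [eF]
  exact coeff_mul_pos (linProdInv_coeff_nonneg hy'0 n)
    (by rw [linProdInv_coeff_zero]; exact one_pos) hpos

/-- Substituting `-X` for `X` turns the denominator into `1 - (x / p₀) X + c` with `c = ∏ (1 + y i
X) - 1`, so now `x / p₀` plays the part of `y` in `coeff_pos_of_mul_eq_one`. -/
theorem genPoly_eval_alternating (hp : 0 < p₀) (hy : ∀ i, 0 < y i)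
    {x T : ℝ} (hT : 0 < T) (hD : p₀ * (linProd y n).eval (-T) ≤ x * T) (m : ℕ) :
    0 < (-1) ^ m * (genPoly (C p₀ * linProd y n) 1 m).eval x := by
  have h1 := congrArg (PowerSeries.rescale (-1 : ℝ))
    (linProd_mul_genSeries_real hp.ne' (y := y) (n := n) le_rfl x)
  set F := genSeries p₀ y n 1 x with hF
  have eX : PowerSeries.rescale (-1 : ℝ) PowerSeries.X = -PowerSeries.X := by
    ext m
    rcases m with _ | _ | m <;> simp [PowerSeries.coeff_X]
  have eC (a : ℝ) : PowerSeries.rescale (-1 : ℝ) (PowerSeries.C a) = PowerSeries.C a := by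
    ext m
    rcases m with _ | m <;> simp [PowerSeries.coeff_rescale, PowerSeries.coeff_C]
  rw [map_mul, rescale_linProd, pow_one, map_add, map_one, map_mul, map_mul, eX, eC] at h1
  set L := linProd (fun i => -y i) n with hL
  have hw : PowerSeries.rescale (-1 : ℝ) F * (1 - PowerSeries.C (p₀⁻¹ * x) * PowerSeries.X +
      ((L - 1 : ℝ[X]) : PowerSeries ℝ)) = 1 := by
    rw [Polynomial.coe_sub, Polynomial.coe_one]
    rw [map_neg] at h1
    linear_combination h1
  have hL0 : L.coeff 0 = 1 := by
    rw [coeff_zero_eq_eval_zero, hL, linProd_eval_zero]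
  have hc0 : PowerSeries.coeff 0 ((L - 1 : ℝ[X]) : PowerSeries ℝ) = 0 := by
    rw [Polynomial.coeff_coe, coeff_sub, hL0]
    simp
  have hcn : ∀ j, 0 ≤ PowerSeries.coeff j ((L - 1 : ℝ[X]) : PowerSeries ℝ) := by
    intro j
    rcases j with _ | j
    · exact hc0.ge
    · rw [Polynomial.coeff_coe, coeff_sub, coeff_one, if_neg (by omega), sub_zero]
      exact linProd_neg_coeff_nonneg hy n _
  have hval : (L - 1).eval T ≤ p₀⁻¹ * x * T - 1 := by
    have : L.eval T = (linProd y n).eval (-T) := by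
      rw [hL, eval_linProd, eval_linProd]
      simp
    rw [eval_sub, eval_one, this]
    have : (linProd y n).eval (-T) ≤ p₀⁻¹ * x * T := by
      rw [mul_assoc, inv_mul_eq_div, le_div_iff₀ hp]
      linarith
    linarith
  have := coeff_pos_of_mul_eq_one hT hw hc0 hcn (fun N =>
    (sum_le_hasSum _ (fun j _ => mul_nonneg (hcn j) (pow_nonneg hT.le j))
      (absEval_coe _ T).2).trans hval) m
  rw [PowerSeries.coeff_rescale, hF, coeff_genSeries] at this
  exact pos_of_mul_pos_right (a := p₀) (by linarith) hp.le

/-! ### Critical points of `-P(t) / t ^ r`. -/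

/-- `∑_{i < n} y i t / (y i t - 1)`, which is `t L'(t) / L(t)` for `L = linProd y n`. -/
noncomputable def logDerivSum (y : ℕ → ℝ) (n : ℕ) (t : ℝ) : ℝ :=
  ∑ i ∈ Finset.range n, y i * t / (y i * t - 1)

theorem mul_derivative_linProd (y : ℕ → ℝ) (n : ℕ) {t : ℝ} (h : ∀ i < n, y i * t ≠ 1) :
    t * (derivative (linProd y n)).eval t = (linProd y n).eval t * logDerivSum y n t := by
  induction n with
  | zero => simp [linProd_zero, logDerivSum]
  | succ n ih =>
    have ih := ih fun i hi => h i (by omega)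
    have hn : y n * t - 1 ≠ 0 := sub_ne_zero.mpr (h n (by omega))
    rw [logDerivSum, Finset.sum_range_succ, ← logDerivSum, linProd_succ, derivative_mul]
    simp only [eval_add, eval_mul, eval_sub, eval_one, eval_C, eval_X, derivative_sub,
      derivative_one, derivative_C_mul, derivative_X, zero_sub, mul_one, eval_neg]
    rw [mul_add, ← mul_assoc, ih]
    field_simp
    ring

/-- Each summand `y t / (y t - 1)` decreases on either side of its pole, and the hypothesis keeps
`u` and `v` on the same side. Hence the critical equation `logDerivSum y n t = r` has at most one
solution between consecutive poles. -/
theorem logDerivSum_lt {y : ℕ → ℝ} (hy : ∀ i, 0 < y i) {n : ℕ} (hn : 1 ≤ n) {u v : ℝ}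
    (huv : u < v) (h : ∀ i < n, 0 < (y i * u - 1) * (y i * v - 1)) :
    logDerivSum y n v < logDerivSum y n u := by
  refine Finset.sum_lt_sum_of_nonempty (Finset.nonempty_range_iff.mpr (by omega)) fun i hi => ?_
  have h1 := h i (Finset.mem_range.mp hi)
  have hu : y i * u - 1 ≠ 0 := left_ne_zero_of_mul h1.ne'
  have hv : y i * v - 1 ≠ 0 := right_ne_zero_of_mul h1.ne'
  have e : y i * u / (y i * u - 1) - y i * v / (y i * v - 1)
      = y i * (v - u) / ((y i * u - 1) * (y i * v - 1)) := by
    field_simp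
    ring
  have : 0 < y i * (v - u) / ((y i * u - 1) * (y i * v - 1)) :=
    div_pos (mul_pos (hy i) (sub_pos.mpr huv)) h1
  linarith

section

variable {p₀ : ℝ} {y : ℕ → ℝ} {n r : ℕ}

theorem critPoly_eval (hr : 1 ≤ r) (P : ℝ[X]) (t : ℝ) : (critPoly P r).eval t
    = t ^ (r - 1) * (r * P.eval t - t * (derivative P).eval t) := by
  obtain ⟨r, rfl⟩ : ∃ k, r = k + 1 := ⟨r - 1, by omega⟩
  simp [critPoly]
  ring

theorem critPoly_eval_linProd (hr : 1 ≤ r) {t : ℝ} (h : ∀ i < n, y i * t ≠ 1) :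
    (critPoly (C p₀ * linProd y n) r).eval t
      = t ^ (r - 1) * (p₀ * (linProd y n).eval t * (r - logDerivSum y n t)) := by
  rw [critPoly_eval hr, derivative_C_mul, eval_C_mul, eval_C_mul, mul_left_comm t,
    mul_derivative_linProd y n h]
  ring

theorem linProd_eval_pos {t : ℝ} (h : ∀ i < n, y i * t < 1) : 0 < (linProd y n).eval t := by
  rw [eval_linProd]
  exact Finset.prod_pos fun i hi => sub_pos.mpr (h i (Finset.mem_range.mp hi))

theorem linProd_eval_neg (hn : 1 ≤ n) {t : ℝ} (h0 : 1 < y 0 * t)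
    (h : ∀ i < n, 1 ≤ i → y i * t < 1) : (linProd y n).eval t < 0 := by
  obtain ⟨n, rfl⟩ : ∃ k, n = k + 1 := ⟨n - 1, by omega⟩
  rw [linProd_succ', eval_mul]
  refine mul_neg_of_pos_of_neg (linProd_eval_pos fun i hi => h (i + 1) (by omega) (by omega)) ?_
  simpa using h0

theorem critPoly_eval_pos (hp : 0 < p₀) (hy : ∀ i, 0 < y i) (hr : 1 ≤ r) {t : ℝ} (ht : 0 < t)
    (h : ∀ i < n, y i * t < 1) : 0 < (critPoly (C p₀ * linProd y n) r).eval t := by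
  rw [critPoly_eval_linProd hr fun i hi => (h i hi).ne]
  have h1 : logDerivSum y n t ≤ 0 := by
    refine Finset.sum_nonpos fun i hi => ?_
    have := h i (Finset.mem_range.mp hi)
    exact div_nonpos_of_nonneg_of_nonpos (mul_pos (hy i) ht).le (by linarith)
  have h2 : (1 : ℝ) ≤ r := by exact_mod_cast hr
  have h3 := linProd_eval_pos h
  have h4 : 0 < (r : ℝ) - logDerivSum y n t := by linarith
  positivity

/-- At a simple zero of `P` only the term `-t ^ r P'(t)` survives, and `P` decreases through its
smallest zero. -/
theorem critPoly_eval_at_zero (hp : 0 < p₀) (hy : ∀ i, 0 < y i) (hr : 1 ≤ r) (hn : 1 ≤ n) {t : ℝ}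
    (h0 : y 0 * t = 1) (h : ∀ i < n, 1 ≤ i → y i * t < 1) :
    0 < (critPoly (C p₀ * linProd y n) r).eval t := by
  obtain ⟨n, rfl⟩ : ∃ k, n = k + 1 := ⟨n - 1, by omega⟩
  have ht : 0 < t := pos_of_mul_pos_right (h0 ▸ one_pos) (hy 0).le
  have hQ : 0 < (linProd (fun i => y (i + 1)) n).eval t :=
    linProd_eval_pos fun i hi => h (i + 1) (by omega) (by omega)
  rw [critPoly_eval hr, derivative_C_mul, linProd_succ', derivative_mul]
  simp only [eval_add, eval_mul, eval_sub, eval_one, eval_C, eval_X, derivative_sub,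
      derivative_one, derivative_C_mul, derivative_X, zero_sub, mul_one, eval_neg, h0, sub_self,
      mul_zero, zero_add]
  have := hy 0
  have : 0 < t ^ (r - 1) * (t * (p₀ * (eval t (linProd (fun i => y (i + 1)) n) * y 0))) := by
    positivity
  linarith

theorem differentiableAt_neg_div_pow (P : ℝ[X]) (r : ℕ) {t : ℝ} (ht : t ≠ 0) :
    DifferentiableAt ℝ (fun s : ℝ => -P.eval s / s ^ r) t :=
  (P.differentiable t).neg.div (differentiableAt_pow r) (pow_ne_zero r ht)

theorem deriv_neg_div_pow (P : ℝ[X]) (r : ℕ) {t : ℝ} (ht : t ≠ 0) :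
    deriv (fun s : ℝ => -P.eval s / s ^ r) t = (critPoly P r).eval t / t ^ (2 * r) := by
  rw [critPoly_eval_eq P r ht, mul_div_cancel_left₀ _ (pow_ne_zero _ ht)]

theorem neg_div_pow_le {P : ℝ[X]} {r : ℕ} {u v : ℝ} (huv : u ≤ v)
    (h0 : ∀ s ∈ Set.Icc u v, s ≠ 0)
    (h : ∀ s ∈ Set.Ioo u v, 0 ≤ (critPoly P r).eval s) :
    -P.eval u / u ^ r ≤ -P.eval v / v ^ r := by
  have := monotoneOn_of_deriv_nonneg (convex_Icc u v) (f := fun s : ℝ => -P.eval s / s ^ r)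
    (fun s hs => (differentiableAt_neg_div_pow P r (h0 s hs)).continuousAt.continuousWithinAt)
    (fun s hs => (differentiableAt_neg_div_pow P r
      (h0 s (interior_subset hs))).differentiableWithinAt)
    (fun s hs => by
      rw [deriv_neg_div_pow P r (h0 s (interior_subset hs))]
      rw [interior_Icc] at hs
      exact div_nonneg (h s hs) (by rw [pow_mul]; positivity))
  exact this (Set.left_mem_Icc.mpr huv) (Set.right_mem_Icc.mpr huv) huv

theorem neg_div_pow_ge {P : ℝ[X]} {r : ℕ} {u v : ℝ} (huv : u ≤ v)
    (h0 : ∀ s ∈ Set.Icc u v, s ≠ 0)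
    (h : ∀ s ∈ Set.Ioo u v, (critPoly P r).eval s ≤ 0) :
    -P.eval v / v ^ r ≤ -P.eval u / u ^ r := by
  have := antitoneOn_of_deriv_nonpos (convex_Icc u v) (f := fun s : ℝ => -P.eval s / s ^ r)
    (fun s hs => (differentiableAt_neg_div_pow P r (h0 s hs)).continuousAt.continuousWithinAt)
    (fun s hs => (differentiableAt_neg_div_pow P r
      (h0 s (interior_subset hs))).differentiableWithinAt)
    (fun s hs => by
      rw [deriv_neg_div_pow P r (h0 s (interior_subset hs))]
      rw [interior_Icc] at hs
      exact div_nonpos_of_nonpos_of_nonneg (h s hs) (by rw [pow_mul]; positivity))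
  exact this (Set.left_mem_Icc.mpr huv) (Set.right_mem_Icc.mpr huv) huv

theorem critPoly_ne_zero (hp : 0 < p₀) (hy : ∀ i, 0 < y i)
    (hanti : ∀ i j, i ≤ j → j < n → y j ≤ y i) (hr : 1 ≤ r) :
    critPoly (C p₀ * linProd y n) r ≠ 0 := by
  intro h
  have h0 := hy 0
  -- The point `1 / (2 y 0)` lies to the left of every zero of `P`.
  have := critPoly_eval_pos hp hy hr (n := n) (t := (2 * y 0)⁻¹) (by positivity) fun i hi => by
    have h1 := hanti 0 i (by omega) hi
    rw [← div_eq_mul_inv, div_lt_one (by positivity)]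
    linarith
  simp [h] at this

theorem finite_critPoly_roots (hp : 0 < p₀) (hy : ∀ i, 0 < y i)
    (hanti : ∀ i j, i ≤ j → j < n → y j ≤ y i) (hr : 1 ≤ r) :
    {t : ℝ | (critPoly (C p₀ * linProd y n) r).IsRoot t}.Finite :=
  Polynomial.finite_setOfPred_isRoot (critPoly_ne_zero hp hy hanti hr)

/-- Rolle's theorem for `-P(t) / t ^ r` between the two smallest zeros of `P`. -/
theorem exists_critPoly_root_of_lt (hy : ∀ i, 0 < y i)
    (hn : 2 ≤ n) (h10 : y 1 < y 0) :
    ∃ c, (critPoly (C p₀ * linProd y n) r).IsRoot c ∧ 1 < y 0 * c ∧ y 1 * c < 1 := by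
  have h0 := hy 0
  have h1 := hy 1
  have hlt : (y 0)⁻¹ < (y 1)⁻¹ := (inv_lt_inv₀ h0 h1).mpr h10
  have hz (i : ℕ) (hi : i < n) : (C p₀ * linProd y n).eval (y i)⁻¹ = 0 := by
    rw [eval_C_mul, eval_linProd, Finset.prod_eq_zero (Finset.mem_range.mpr hi), mul_zero]
    rw [mul_inv_cancel₀ (hy i).ne', sub_self]
  obtain ⟨c, hc, hd⟩ := exists_deriv_eq_zero (f := fun s : ℝ =>
    -(C p₀ * linProd y n).eval s / s ^ r) hlt
    (fun s hs => (differentiableAt_neg_div_pow _ r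
      ((inv_pos.mpr h0).trans_le hs.1).ne').continuousAt.continuousWithinAt)
    (by rw [hz 0 (by omega), hz 1 (by omega)]; simp)
  have hc0 : 0 < c := (inv_pos.mpr h0).trans hc.1
  refine ⟨c, ?_, ?_, ?_⟩
  · rw [IsRoot.def, critPoly_eval_eq _ _ hc0.ne', hd, mul_zero]
  · have := (inv_lt_iff_one_lt_mul₀' h0).mp hc.1
    exact this
  · have := mul_lt_mul_of_pos_left hc.2 h1
    rwa [mul_inv_cancel₀ h1.ne'] at this

theorem critPoly_root_of_eq (hr : 1 ≤ r) (hn : 2 ≤ n) (h0 : 0 < y 0) (h10 : y 1 = y 0) :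
    (critPoly (C p₀ * linProd y n) r).IsRoot (y 0)⁻¹ := by
  obtain ⟨n, rfl⟩ : ∃ k, n = k + 2 := ⟨n - 2, by omega⟩
  rw [IsRoot.def, critPoly_eval hr, linProd_succ', linProd_succ', derivative_C_mul, derivative_mul,
    derivative_mul]
  simp [h10, h0.ne']

theorem exists_pos_critPoly_root (hy : ∀ i, 0 < y i)
    (hanti : ∀ i j, i ≤ j → j < n → y j ≤ y i) (hr : 1 ≤ r) (hn : 1 ≤ n) (hnr : 1 < max n r) :
    ∃ t, 0 < t ∧ (critPoly (C p₀ * linProd y n) r).IsRoot t := by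
  have h0 := hy 0
  rcases hn.eq_or_lt with rfl | hn
  · have hr2 : 2 ≤ r := by omega
    have hr' : (2 : ℝ) ≤ r := by exact_mod_cast hr2
    have hr1 : (0 : ℝ) < r - 1 := by linarith
    refine ⟨r / ((r - 1) * y 0), by positivity, ?_⟩
    rw [IsRoot.def, critPoly_eval hr, linProd_succ, linProd_zero, one_mul]
    simp
    right
    field_simp
    ring
  · rcases (hanti 0 1 (by omega) (by omega)).eq_or_lt with h | h
    · exact ⟨_, inv_pos.mpr h0, critPoly_root_of_eq hr hn h0 h⟩
    · obtain ⟨c, hc, hc1, -⟩ := exists_critPoly_root_of_lt hy hn h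
      exact ⟨c, pos_of_mul_pos_right (one_pos.trans hc1) h0.le, hc⟩

/-- The local maximum of `-P(t) / t ^ r` at the smallest positive critical point. -/
theorem leftEnd_spec (hp : 0 < p₀) (hy : ∀ i, 0 < y i)
    (hanti : ∀ i j, i ≤ j → j < n → y j ≤ y i) (hr : 1 ≤ r) (hn : 1 ≤ n) {ta : ℝ}
    (hta : IsLeast {t : ℝ | 0 < t ∧ (critPoly (C p₀ * linProd y n) r).IsRoot t} ta) :
    0 ≤ leftEnd (C p₀ * linProd y n) r ta ∧
    (0 < leftEnd (C p₀ * linProd y n) r ta → ∀ i < n, 1 ≤ i → y i * ta < 1) ∧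
    ∀ t, 1 < y 0 * t → (∀ i < n, 1 ≤ i → y i * t < 1) →
      -(C p₀ * linProd y n).eval t / t ^ r ≤ leftEnd (C p₀ * linProd y n) r ta := by
  obtain ⟨⟨hta0, htar⟩, hmin⟩ := hta
  have h0 := hy 0
  have hge : 1 ≤ y 0 * ta := by
    by_contra! hlt
    have := critPoly_eval_pos hp hy hr hta0 (n := n) fun i hi =>
      (mul_le_mul_of_nonneg_right (hanti 0 i (by omega) hi) hta0.le).trans_lt hlt
    exact this.ne' htar
  -- A multiple smallest zero of `P` is itself critical: then `ta = 1 / y 0`, `a = 0`, and the last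
  -- claim is vacuous.
  by_cases hmult : 2 ≤ n ∧ y 1 = y 0
  · obtain ⟨hn2, h10⟩ := hmult
    have hle := hmin ⟨inv_pos.mpr h0, critPoly_root_of_eq hr hn2 h0 h10⟩
    have hta1 : y 0 * ta = 1 := by
      apply le_antisymm _ hge
      have := mul_le_mul_of_nonneg_left hle h0.le
      rwa [mul_inv_cancel₀ h0.ne'] at this
    have hz : leftEnd (C p₀ * linProd y n) r ta = 0 := by
      rw [leftEnd, eval_C_mul, eval_linProd, Finset.prod_eq_zero (Finset.mem_range.mpr
        (show 0 < n by omega)) (by rw [hta1, sub_self])]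
      simp
    rw [hz]
    refine ⟨le_rfl, fun h => (lt_irrefl _ h).elim, fun t ht0 ht => ?_⟩
    have := ht 1 (by omega) le_rfl
    rw [h10] at this
    exact (this.trans ht0).false.elim
  · have hlt : ∀ i < n, 1 ≤ i → y i < y 0 := by
      intro i hi hi1
      have h1 := hanti 1 i hi1 hi
      have h2 := hanti 0 1 (by omega) (by omega)
      have h3 : y 1 ≠ y 0 := fun h => hmult ⟨by omega, h⟩
      exact h1.trans_lt (lt_of_le_of_ne h2 h3)
    have hother : ∀ i < n, 1 ≤ i → y i * ta < 1 := by
      intro i hi hi1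
      obtain ⟨c, hc, hc1, hc2⟩ := exists_critPoly_root_of_lt hy (n := n) (by omega)
        (hlt 1 (by omega) le_rfl)
      have hc0 : 0 < c := pos_of_mul_pos_right (one_pos.trans hc1) h0.le
      calc y i * ta ≤ y 1 * ta := mul_le_mul_of_nonneg_right (hanti 1 i hi1 hi) hta0.le
        _ ≤ y 1 * c := mul_le_mul_of_nonneg_left (hmin ⟨hc0, hc⟩) (hy 1).le
        _ < 1 := hc2
    have hgt : 1 < y 0 * ta := by
      refine lt_of_le_of_ne hge fun h => ?_
      exact (critPoly_eval_at_zero hp hy hr hn h.symm hother).ne' htar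
    have hL := linProd_eval_neg hn hgt hother
    have hne : ∀ t, 1 < y 0 * t → (∀ i < n, 1 ≤ i → y i * t < 1) → ∀ i < n, y i * t ≠ 1 := by
      intro t ht0 ht i hi
      rcases Nat.eq_zero_or_pos i with rfl | hi1
      · exact ht0.ne'
      · exact (ht i hi hi1).ne
    have hf : logDerivSum y n ta = r := by
      rw [IsRoot.def, critPoly_eval_linProd hr (hne ta hgt hother)] at htar
      have h1 := (mul_eq_zero.mp htar).resolve_left (pow_ne_zero _ hta0.ne')
      have h2 := (mul_eq_zero.mp h1).resolve_left (mul_ne_zero hp.ne' hL.ne)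
      linarith
    refine ⟨?_, fun _ => hother, ?_⟩
    · rw [leftEnd, eval_C_mul]
      have := mul_neg_of_pos_of_neg hp hL
      exact div_nonneg (by linarith) (pow_nonneg hta0.le r)
    · intro t ht0 ht
      have htp : 0 < t := pos_of_mul_pos_right (one_pos.trans ht0) h0.le
      rw [leftEnd]
      -- Here `linProd y n` is negative, so `critPoly` has the sign of `logDerivSum - r`: positive
      -- before `ta`, negative after.
      rcases lt_trichotomy t ta with h | rfl | h
      · refine neg_div_pow_le h.le (fun s hs => (htp.trans_le hs.1).ne') fun s hs => ?_
        have hs0 : 0 < s := htp.trans hs.1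
        have hs1 : 1 < y 0 * s := ht0.trans (mul_lt_mul_of_pos_left hs.1 h0)
        have hs2 : ∀ i < n, 1 ≤ i → y i * s < 1 := fun i hi hi1 =>
          (mul_lt_mul_of_pos_left hs.2 (hy i)).trans (hother i hi hi1)
        have hfs := logDerivSum_lt hy hn hs.2 fun i hi => by
          rcases Nat.eq_zero_or_pos i with rfl | hi1
          · exact mul_pos (by linarith) (by linarith)
          · exact mul_pos_of_neg_of_neg (by linarith [hs2 i hi hi1])
              (by linarith [hother i hi hi1])
        rw [critPoly_eval_linProd hr (hne s hs1 hs2)]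
        have hLs := linProd_eval_neg hn hs1 hs2
        refine mul_nonneg (pow_nonneg hs0.le _) (mul_nonneg_of_nonpos_of_nonpos
          (mul_neg_of_pos_of_neg hp hLs).le (by linarith))
      · rfl
      · refine neg_div_pow_ge h.le (fun s hs => (hta0.trans_le hs.1).ne') fun s hs => ?_
        have hs0 : 0 < s := hta0.trans hs.1
        have hs1 : 1 < y 0 * s := hgt.trans (mul_lt_mul_of_pos_left hs.1 h0)
        have hs2 : ∀ i < n, 1 ≤ i → y i * s < 1 := fun i hi hi1 =>
          (mul_lt_mul_of_pos_left hs.2 (hy i)).trans (ht i hi hi1)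
        have hfs := logDerivSum_lt hy hn hs.1 fun i hi => by
          rcases Nat.eq_zero_or_pos i with rfl | hi1
          · exact mul_pos (by linarith) (by linarith)
          · exact mul_pos_of_neg_of_neg (by linarith [hother i hi hi1])
              (by linarith [hs2 i hi hi1])
        rw [critPoly_eval_linProd hr (hne s hs1 hs2)]
        have hLs := linProd_eval_neg hn hs1 hs2
        refine mul_nonpos_of_nonneg_of_nonpos (pow_nonneg hs0.le _)
          (mul_nonpos_of_nonpos_of_nonneg (mul_neg_of_pos_of_neg hp hLs).le (by linarith))

theorem critPoly_isRoot_zero (hr : 2 ≤ r) (P : ℝ[X]) : (critPoly P r).IsRoot 0 := by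
  rw [IsRoot.def, critPoly_eval (by omega), zero_pow (by omega), zero_mul]

theorem exists_neg_critPoly_root (hp : 0 < p₀) (hy : ∀ i, 0 < y i)
    (hanti : ∀ i j, i ≤ j → j < n → y j ≤ y i) (hn : 2 ≤ n) :
    ∃ t, t ≤ 0 ∧ (critPoly (C p₀ * linProd y n) 1).IsRoot t := by
  have hm := hy (n - 1)
  -- Every `y i * T` then exceeds `1`, so each term of `logDerivSum` at `-T` exceeds `1 / 2` and the
  -- sum exceeds `n / 2 ≥ 1 = r`.
  set T := 2 / y (n - 1) with hT
  have hT0 : 0 < T := by positivity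
  have hyT : ∀ i < n, 1 < y i * T := by
    intro i hi
    have h1 := hanti i (n - 1) (by omega) (by omega)
    calc 1 < y (n - 1) * T := by rw [hT, mul_div_cancel₀ _ hm.ne']; norm_num
      _ ≤ y i * T := by gcongr
  have h0 : 0 < (critPoly (C p₀ * linProd y n) 1).eval 0 := by
    rw [critPoly_eval le_rfl, eval_C_mul, linProd_eval_zero]
    simpa using hp
  have h1 : (critPoly (C p₀ * linProd y n) 1).eval (-T) < 0 := by
    rw [critPoly_eval_linProd le_rfl fun i hi => by linarith [hyT i hi]]
    have hL : 0 < (linProd y n).eval (-T) := linProd_eval_pos fun i hi => by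
      linarith [hyT i hi]
    have hf : 1 < logDerivSum y n (-T) := by
      have : ∑ i ∈ Finset.range n, (1 / 2 : ℝ) < logDerivSum y n (-T) := by
        refine Finset.sum_lt_sum_of_nonempty (Finset.nonempty_range_iff.mpr (by omega))
          fun i hi => ?_
        have := hyT i (Finset.mem_range.mp hi)
        rw [show y i * -T / (y i * -T - 1) = y i * T / (y i * T + 1) by
          rw [← neg_div_neg_eq]; ring_nf, div_lt_div_iff₀ (by norm_num) (by linarith)]
        linarith
      rw [Finset.sum_const, Finset.card_range, nsmul_eq_mul] at this
      have h2 : (2 : ℝ) ≤ n := by exact_mod_cast hn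
      linarith
    have := mul_neg_of_pos_of_neg (mul_pos hp hL) (show ((1 : ℕ) : ℝ) - logDerivSum y n (-T) < 0 by
      push_cast; linarith)
    simpa using this
  obtain ⟨t, ht, ht0⟩ := intermediate_value_Icc (show -T ≤ 0 by linarith)
    (critPoly (C p₀ * linProd y n) 1).continuous.continuousOn ⟨h1.le, h0.le⟩
  exact ⟨t, ht.2, ht0⟩

/-- All poles of `logDerivSum` are positive, so it is strictly decreasing on the negative axis and
`tb` is the only critical point there, a global minimum. -/
theorem rightEnd_spec (hp : 0 < p₀) (hy : ∀ i, 0 < y i) (hn : 1 ≤ n) {tb : ℝ}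
    (htb : IsGreatest {t : ℝ | t ≤ 0 ∧ (critPoly (C p₀ * linProd y n) 1).IsRoot t} tb) :
    tb < 0 ∧ ∀ t < 0, -(C p₀ * linProd y n).eval tb / tb ≤ -(C p₀ * linProd y n).eval t / t := by
  obtain ⟨⟨htb0, htbr⟩, -⟩ := htb
  have hlt : tb < 0 := by
    refine lt_of_le_of_ne htb0 ?_
    rintro rfl
    rw [IsRoot.def, critPoly_eval le_rfl, eval_C_mul, linProd_eval_zero] at htbr
    simp at htbr
    exact hp.ne' htbr
  have hneg : ∀ t < 0, ∀ i < n, y i * t < 1 := fun t ht i _ =>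
    (mul_neg_of_pos_of_neg (hy i) ht).trans one_pos
  have hf : logDerivSum y n tb = 1 := by
    rw [IsRoot.def, critPoly_eval_linProd le_rfl fun i hi => (hneg tb hlt i hi).ne] at htbr
    have h1 := (mul_eq_zero.mp htbr).resolve_left (pow_ne_zero _ hlt.ne)
    have h2 := (mul_eq_zero.mp h1).resolve_left
      (mul_ne_zero hp.ne' (linProd_eval_pos (hneg tb hlt)).ne')
    push_cast at h2
    linarith
  refine ⟨hlt, fun t ht => ?_⟩
  have hflt : ∀ u v : ℝ, u < v → v < 0 → logDerivSum y n v < logDerivSum y n u := fun u v huv hv =>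
    logDerivSum_lt hy hn huv fun i hi => mul_pos_of_neg_of_neg
      (by linarith [hneg u (huv.trans hv) i hi]) (by linarith [hneg v hv i hi])
  rcases lt_trichotomy t tb with h | rfl | h
  · have := neg_div_pow_ge (P := C p₀ * linProd y n) (r := 1) h.le
      (fun s hs => (hs.2.trans_lt hlt).ne) fun s hs => by
        have hs0 := hs.2.trans hlt
        rw [critPoly_eval_linProd le_rfl fun i hi => (hneg s hs0 i hi).ne, Nat.sub_self, pow_zero,
          one_mul]
        refine mul_nonpos_of_nonneg_of_nonpos (mul_pos hp (linProd_eval_pos (hneg s hs0))).le ?_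
        have := hflt s tb hs.2 hlt
        push_cast
        linarith
    simpa using this
  · rfl
  · have := neg_div_pow_le (P := C p₀ * linProd y n) (r := 1) h.le
      (fun s hs => (hs.2.trans_lt ht).ne) fun s hs => by
        have hs0 := hs.2.trans ht
        rw [critPoly_eval_linProd le_rfl fun i hi => (hneg s hs0 i hi).ne, Nat.sub_self, pow_zero,
          one_mul]
        refine mul_nonneg (mul_pos hp (linProd_eval_pos (hneg s hs0))).le ?_
        have := hflt tb s hs.1 hs0
        push_cast
        linarith
    simpa using this

end

/-! ### Coefficient asymptotics from the zeros of least modulus. -/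

section Asymptotics

open Filter Topology

/-- The finitely many zeros lie strictly outside the closed disk, so the geometric series of the
linear factors converge on its boundary too. -/
theorem exists_inv_absEval {ρ : ℝ} (hρ : 0 ≤ ρ) (N : ℕ) : ∀ K : ℂ[X], K.natDegree = N →
    (∀ z, ‖z‖ ≤ ρ → K.eval z ≠ 0) →
    ∃ g : PowerSeries ℂ, (K : PowerSeries ℂ) * g = 1 ∧
      ∀ t, ‖t‖ ≤ ρ → AbsEval g t (K.eval t)⁻¹ := by
  induction N with
  | zero =>
    intro K hN hK
    obtain ⟨c, rfl⟩ : ∃ c, K = C c := ⟨_, eq_C_of_natDegree_eq_zero hN⟩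
    have hc : c ≠ 0 := by simpa using hK 0 (by simpa)
    refine ⟨((C c⁻¹ : ℂ[X]) : PowerSeries ℂ), ?_, fun t _ => ?_⟩
    · rw [← Polynomial.coe_mul, ← C_mul, mul_inv_cancel₀ hc]
      simp
    · have := absEval_coe (C c⁻¹) t
      rwa [eval_C] at this ⊢
  | succ N ih =>
    intro K hN hK
    obtain ⟨a, ha⟩ := Complex.exists_root (f := K)
      (natDegree_pos_iff_degree_pos.mp (by omega))
    have haρ : ρ < ‖a‖ := by
      by_contra! h
      exact hK a h ha
    have ha0 : a ≠ 0 := norm_pos_iff.mp (hρ.trans_lt haρ)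
    obtain ⟨Q, rfl⟩ := dvd_iff_isRoot.mpr ha
    have hK0 : (X - C a) * Q ≠ 0 := by
      intro h
      rw [h] at hN
      simp at hN
    have hQN : Q.natDegree = N := by
      rw [natDegree_mul (left_ne_zero_of_mul hK0) (right_ne_zero_of_mul hK0),
        natDegree_X_sub_C] at hN
      omega
    obtain ⟨g, hg, hgt⟩ := ih Q hQN fun z hz h => hK z hz (by simp [h])
    have e1 : (X - C a : ℂ[X]) = C (-a) * (1 - C a⁻¹ * X) := by
      rw [mul_sub, ← mul_assoc, ← C_mul]
      simp [ha0]
      ring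
    refine ⟨((C (-a)⁻¹ : ℂ[X]) : PowerSeries ℂ) * PowerSeries.mk (fun m => a⁻¹ ^ m) * g, ?_,
      fun t ht => ?_⟩
    · have h1 := one_sub_mul_geom (A := ℂ) a⁻¹
      have h2 : ((C (-a) : ℂ[X]) : PowerSeries ℂ) * ((C (-a)⁻¹ : ℂ[X]) : PowerSeries ℂ) = 1 := by
        rw [← Polynomial.coe_mul, ← C_mul, mul_inv_cancel₀ (neg_ne_zero.mpr ha0)]
        simp
      rw [e1, Polynomial.coe_mul, Polynomial.coe_mul]
      calc _ = (((C (-a) : ℂ[X]) : PowerSeries ℂ) * ((C (-a)⁻¹ : ℂ[X]) : PowerSeries ℂ)) *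
            (((1 - C a⁻¹ * X : ℂ[X]) : PowerSeries ℂ) * PowerSeries.mk (fun m => a⁻¹ ^ m)) *
              (Q * g) := by ring
        _ = 1 := by rw [h1, h2, hg]; ring
    · have h1 : ‖a⁻¹ * t‖ < 1 := by
        rw [norm_mul, norm_inv, inv_mul_eq_div, div_lt_one (norm_pos_iff.mpr ha0)]
        exact ht.trans_lt haρ
      have h2 := ((absEval_coe (C (-a)⁻¹) t).mul (absEval_geom h1)).mul (hgt t ht)
      rw [e1]
      convert h2 using 1
      simp
      ring

/-- Dividing by `1 - X / t` takes partial sums: `coeff m G * t ^ m` is a partial sum of the series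
of `1 / K` at `t`. -/
theorem tendsto_coeff_mul_pow {K : ℂ[X]} {t : ℂ} (ht : t ≠ 0)
    (hK : ∀ z, ‖z‖ ≤ ‖t‖ → K.eval z ≠ 0) {G : PowerSeries ℂ}
    (hG : (K : PowerSeries ℂ) * ((1 - PowerSeries.C t⁻¹ * PowerSeries.X) * G) = 1) :
    Tendsto (fun m => PowerSeries.coeff m G * t ^ m) atTop (𝓝 (K.eval t)⁻¹) := by
  obtain ⟨g, hg, hgt⟩ := exists_inv_absEval (norm_nonneg t) _ K rfl hK
  have e : g = (1 - PowerSeries.C t⁻¹ * PowerSeries.X) * G := by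
    linear_combination (1 - PowerSeries.C t⁻¹ * PowerSeries.X) * G * hg - g * hG
  have hsum (m : ℕ) : PowerSeries.coeff m G * t ^ m
      = ∑ k ∈ Finset.range (m + 1), PowerSeries.coeff k g * t ^ k := by
    have e' : g = G - PowerSeries.C t⁻¹ * (PowerSeries.X * G) := by rw [e]; ring
    induction m with
    | zero => simp [e']
    | succ m ih =>
      rw [Finset.sum_range_succ, ← ih, e', map_sub, PowerSeries.coeff_C_mul,
        PowerSeries.coeff_succ_X_mul]
      field_simp
      ring
  simp only [hsum]
  exact (hgt t le_rfl).2.tendsto_sum_nat.comp (tendsto_add_atTop_nat 1)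

/-- The denominator `∏_{i < n} (1 - y i X) + q X ^ r`. -/
noncomputable def denPoly (y : ℕ → ℝ) (n r : ℕ) (q : ℝ) : ℝ[X] :=
  linProd y n + C q * X ^ r

theorem denPoly_mul_genSeries {p₀ : ℝ} (hp : p₀ ≠ 0) {y : ℕ → ℝ} {n r : ℕ} (hr : 1 ≤ r) (x : ℝ) :
    (denPoly y n r (p₀⁻¹ * x) : PowerSeries ℝ) * genSeries p₀ y n r x = 1 := by
  have h := linProd_mul_genSeries_real hp (y := y) (n := n) hr x
  simp only [denPoly, Polynomial.coe_add, Polynomial.coe_mul, Polynomial.coe_C,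
    Polynomial.coe_pow, Polynomial.coe_X]
  rw [map_neg] at h
  linear_combination h

variable {D : ℝ[X]} {F : PowerSeries ℝ}

theorem denominator_eval_zero_ne (hDF : (D : PowerSeries ℝ) * F = 1) : aeval (0 : ℂ) D ≠ 0 := by
  intro h
  have h1 := congrArg PowerSeries.constantCoeff hDF
  rw [map_mul, Polynomial.constantCoeff_coe, coeff_zero_eq_eval_zero] at h1
  have h2 := Polynomial.aeval_algebraMap_apply ℂ (0 : ℝ) D
  rw [map_zero, h, Polynomial.coe_aeval_eq_eval] at h2
  have h3 : D.eval 0 = 0 := by simpa using h2.symm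
  simp [h3] at h1

theorem map_mul_map_eq_one (hDF : (D : PowerSeries ℝ) * F = 1) :
    ((D.map (algebraMap ℝ ℂ) : ℂ[X]) : PowerSeries ℂ) * F.map (algebraMap ℝ ℂ) = 1 := by
  rw [Polynomial.polynomial_map_coe, ← map_mul, hDF, map_one]

theorem exists_tendsto_of_real_root (hDF : (D : PowerSeries ℝ) * F = 1) {s : ℝ}
    (hs : aeval (s : ℂ) D = 0) (hs' : aeval (s : ℂ) (derivative D) ≠ 0)
    (hmin : ∀ z : ℂ, aeval z D = 0 → ‖z‖ ≤ |s| → z = s) :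
    ∃ β : ℝ, β ≠ 0 ∧ Tendsto (fun m => PowerSeries.coeff m F * s ^ m) atTop (𝓝 β) := by
  have hDc := map_mul_map_eq_one hDF
  have hs0 : (s : ℂ) ≠ 0 := by
    intro h
    rw [h] at hs
    exact denominator_eval_zero_ne hDF hs
  obtain ⟨Q, hQ⟩ := dvd_iff_isRoot.mpr (show (D.map (algebraMap ℝ ℂ)).IsRoot (s : ℂ) by
    rwa [IsRoot.def, eval_map_algebraMap])
  have hder : aeval (s : ℂ) (derivative D) = Q.eval (s : ℂ) := by
    rw [← eval_map_algebraMap, ← derivative_map, hQ, derivative_mul]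
    simp
  have hQ0 : ∀ z, ‖z‖ ≤ ‖(s : ℂ)‖ → (C (-(s : ℂ)) * Q).eval z ≠ 0 := by
    intro z hz h
    have hz0 : Q.eval z = 0 := by simpa [hs0] using h
    have := hmin z (by rw [← eval_map_algebraMap, hQ, eval_mul, hz0, mul_zero])
      (by simpa using hz)
    rw [this, ← hder] at hz0
    exact hs' hz0
  have h := tendsto_coeff_mul_pow hs0 hQ0 (G := F.map (algebraMap ℝ ℂ)) (by
    refine Eq.trans ?_ hDc
    rw [hQ]
    simp only [Polynomial.coe_mul, Polynomial.coe_sub, Polynomial.coe_C, Polynomial.coe_X]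
    rw [map_neg]
    have : PowerSeries.C (s : ℂ) * PowerSeries.C (s : ℂ)⁻¹ = 1 := by
      rw [← map_mul, mul_inv_cancel₀ hs0, map_one]
    linear_combination Q * PowerSeries.X * F.map (algebraMap ℝ ℂ) * this)
  have e : (fun m => PowerSeries.coeff m (F.map (algebraMap ℝ ℂ)) * (s : ℂ) ^ m)
      = fun m => ((PowerSeries.coeff m F * s ^ m : ℝ) : ℂ) := by
    funext m
    simp
  rw [e] at h
  set B := ((C (-(s : ℂ)) * Q).eval (s : ℂ))⁻¹ with hB
  have hB0 : B ≠ 0 := inv_ne_zero (hQ0 _ le_rfl)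
  have hre := (Complex.continuous_re.tendsto B).comp h
  have him := (Complex.continuous_im.tendsto B).comp h
  simp only [Function.comp_def, Complex.ofReal_re, Complex.ofReal_im] at hre him
  refine ⟨B.re, fun h0 => hB0 (Complex.ext h0 (tendsto_nhds_unique him tendsto_const_nhds)), hre⟩

/-- Remove the factor of `conj t` by applying `tendsto_coeff_mul_pow` to `(1 - X / conj t) F`. The
realness of `F` then recovers its coefficients, with no separate treatment of the second pole. -/
theorem exists_tendsto_of_nonreal_root (hDF : (D : PowerSeries ℝ) * F = 1) {t : ℂ}
    (him : t.im ≠ 0) (ht : aeval t D = 0) (ht' : aeval t (derivative D) ≠ 0)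
    (hmin : ∀ z : ℂ, aeval z D = 0 → ‖z‖ ≤ ‖t‖ → z = t ∨ z = starRingEnd ℂ t) :
    ∃ β : ℂ, β ≠ 0 ∧ Tendsto (fun m => PowerSeries.coeff m F * ‖t‖ ^ m -
      (β * (t / ‖t‖) ^ m).re) atTop (𝓝 0) := by
  have hDc := map_mul_map_eq_one hDF
  have ht0 : t ≠ 0 := by
    rintro rfl
    simp at him
  set t' := starRingEnd ℂ t with ht'def
  have ht'0 : t' ≠ 0 := by simpa [ht'def] using ht0
  have htt' : t' ≠ t := fun h => him (Complex.conj_eq_iff_im.mp h)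
  obtain ⟨Q, hQ⟩ := dvd_iff_isRoot.mpr (show (D.map (algebraMap ℝ ℂ)).IsRoot t by
    rwa [IsRoot.def, eval_map_algebraMap])
  have hder : aeval t (derivative D) = Q.eval t := by
    rw [← eval_map_algebraMap, ← derivative_map, hQ, derivative_mul]
    simp
  have hroot' : aeval t' D = 0 := by rw [ht'def, aeval_conj, ht, map_zero]
  have hQt' : Q.IsRoot t' := by
    rw [← eval_map_algebraMap, hQ, eval_mul] at hroot'
    exact (mul_eq_zero.mp hroot').resolve_left (by simpa [sub_eq_zero] using htt')
  obtain ⟨K, hK⟩ := dvd_iff_isRoot.mpr hQt'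
  have hder' : aeval t' (derivative D) = (t' - t) * K.eval t' := by
    rw [← eval_map_algebraMap, ← derivative_map, hQ, hK, derivative_mul, derivative_mul]
    simp
  have hder'0 : aeval t' (derivative D) ≠ 0 := by
    rw [ht'def, aeval_conj]
    simpa using ht'
  have hK0 : ∀ z, ‖z‖ ≤ ‖t‖ → (C (t * t') * K).eval z ≠ 0 := by
    intro z hz h
    have hz0 : K.eval z = 0 := by simpa [ht0, ht'0] using h
    rcases hmin z (by rw [← eval_map_algebraMap, hQ, hK, eval_mul, eval_mul, hz0]; simp) hz
      with rfl | rfl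
    · rw [hder, hK, eval_mul, hz0, mul_zero] at ht'
      exact ht' rfl
    · rw [hder', hz0, mul_zero] at hder'0
      exact hder'0 rfl
  set Fc := F.map (algebraMap ℝ ℂ) with hFc
  have h := tendsto_coeff_mul_pow ht0 hK0
    (G := (1 - PowerSeries.C t'⁻¹ * PowerSeries.X) * Fc) (by
    refine Eq.trans ?_ hDc
    rw [hQ, hK]
    simp only [Polynomial.coe_mul, Polynomial.coe_sub, Polynomial.coe_C, Polynomial.coe_X]
    rw [map_mul]
    have h1 : PowerSeries.C t * PowerSeries.C t⁻¹ = 1 := by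
      rw [← map_mul, mul_inv_cancel₀ ht0, map_one]
    have h2 : PowerSeries.C t' * PowerSeries.C t'⁻¹ = 1 := by
      rw [← map_mul, mul_inv_cancel₀ ht'0, map_one]
    calc _ = (K : PowerSeries ℂ) * ((PowerSeries.C t - PowerSeries.C t * PowerSeries.C t⁻¹ *
            PowerSeries.X) * ((PowerSeries.C t' - PowerSeries.C t' * PowerSeries.C t'⁻¹ *
            PowerSeries.X) * Fc)) := by ring
      _ = _ := by rw [h1, h2]; ring)
  set B := ((C (t * t') * K).eval t)⁻¹ with hB
  have hB0 : B ≠ 0 := inv_ne_zero (hK0 _ le_rfl)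
  set τ := ‖t‖ with hτ
  have hτ0 : (τ : ℂ) ≠ 0 := by simpa [hτ] using ht0
  set ω := t / τ with hω
  have htω : t = τ * ω := by rw [hω]; field_simp
  have hωn : ‖ω‖ = 1 := by
    rw [hω, norm_div, ← hτ, Complex.norm_real, Real.norm_of_nonneg (norm_nonneg t)]
    exact div_self (by simpa [hτ] using ht0)
  have hωc : starRingEnd ℂ ω * ω = 1 := by
    rw [mul_comm, Complex.mul_conj, Complex.normSq_eq_norm_sq, hωn]
    simp
  have hωim : ω.im ≠ 0 := by
    intro h0
    apply him
    rw [htω, Complex.im_ofReal_mul, h0, mul_zero]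
  have ht'ω : t'⁻¹ * τ = ω := by
    have : t' = τ * starRingEnd ℂ ω := by rw [ht'def, htω, map_mul, Complex.conj_ofReal]
    rw [this]
    have : starRingEnd ℂ ω ≠ 0 := left_ne_zero_of_mul_eq_one hωc
    field_simp
    linear_combination -hωc
  set u : ℕ → ℝ := fun m => PowerSeries.coeff m F * τ ^ m with hu
  have h1 : Tendsto (fun m => ((u (m + 1) : ℂ) - u m * ω) * ω ^ (m + 1)) atTop (𝓝 B) := by
    have h2 := h.comp (tendsto_add_atTop_nat 1)
    refine h2.congr fun m => ?_
    simp only [Function.comp_def]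
    rw [show (1 - PowerSeries.C t'⁻¹ * PowerSeries.X) * Fc
      = Fc - PowerSeries.C t'⁻¹ * (PowerSeries.X * Fc) by ring, map_sub, PowerSeries.coeff_C_mul,
      PowerSeries.coeff_succ_X_mul, htω, hFc, PowerSeries.coeff_map, PowerSeries.coeff_map]
    simp only [hu, Complex.coe_algebraMap, Complex.ofReal_mul, Complex.ofReal_pow]
    rw [mul_pow, ← ht'ω]
    ring
  have h2 : Tendsto (fun m => (u (m + 1) : ℂ) - u m * ω - B * starRingEnd ℂ ω ^ (m + 1)) atTop
      (𝓝 0) := by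
    rw [tendsto_zero_iff_norm_tendsto_zero]
    have h3 := tendsto_iff_norm_sub_tendsto_zero.mp h1
    refine h3.congr fun m => ?_
    have e : ((u (m + 1) : ℂ) - u m * ω) * ω ^ (m + 1) - B
        = ((u (m + 1) : ℂ) - u m * ω - B * starRingEnd ℂ ω ^ (m + 1)) * ω ^ (m + 1) := by
      have hpow : starRingEnd ℂ ω ^ (m + 1) * ω ^ (m + 1) = 1 := by
        rw [← mul_pow, hωc, one_pow]
      linear_combination B * hpow
    rw [e, norm_mul, norm_pow, hωn, one_pow, mul_one]
  -- Taking imaginary parts kills the real number `u (m + 1)` and leaves `u m` times `-ω.im`, which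
  -- is nonzero.
  have h3 := ((Complex.continuous_im.tendsto 0).comp h2).mul_const (-ω.im⁻¹)
  rw [Complex.zero_im, zero_mul] at h3
  refine ⟨-Complex.I * (starRingEnd ℂ B * ω * (ω.im⁻¹ : ℝ)), ?_, h3.congr fun m => ?_⟩
  · have hω0 : ω ≠ 0 := right_ne_zero_of_mul_eq_one hωc
    simp [hB0, hω0, hωim]
  · have e1 : (B * starRingEnd ℂ ω ^ (m + 1)).im = -(starRingEnd ℂ B * ω ^ (m + 1)).im := by
      rw [← Complex.conj_im, map_mul, map_pow, Complex.conj_conj]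
    have e2 : (-Complex.I * (starRingEnd ℂ B * ω * (ω.im⁻¹ : ℝ)) * ω ^ m).re
        = (starRingEnd ℂ B * ω ^ (m + 1)).im * ω.im⁻¹ := by
      rw [show -Complex.I * (starRingEnd ℂ B * ω * (ω.im⁻¹ : ℝ)) * ω ^ m
        = -Complex.I * ((starRingEnd ℂ B * ω ^ (m + 1)) * (ω.im⁻¹ : ℝ)) by ring]
      rw [Complex.mul_re]
      simp [-Complex.ofReal_inv]
    simp only [Function.comp_def]
    rw [e2, Complex.sub_im, Complex.sub_im, e1, Complex.ofReal_im, Complex.im_ofReal_mul]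
    simp only [hu]
    field_simp
    ring

end Asymptotics

/-! ### Cesàro means and incompatible oscillations. -/

section Cesaro

open Filter Topology

/-- The Cesàro means of `f` tend to `l`. -/
def MeanTendsto (f : ℕ → ℂ) (l : ℂ) : Prop :=
  Tendsto (fun N : ℕ => (N : ℝ)⁻¹ • ∑ i ∈ Finset.range N, f i) atTop (𝓝 l)

namespace MeanTendsto

variable {f g : ℕ → ℂ} {a b : ℂ}

theorem of_tendsto (h : Tendsto f atTop (𝓝 a)) : MeanTendsto f a := h.cesaro_smul

theorem add (hf : MeanTendsto f a) (hg : MeanTendsto g b) :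
    MeanTendsto (fun m => f m + g m) (a + b) := by
  have := Tendsto.add hf hg
  simpa [MeanTendsto, Finset.sum_add_distrib, smul_add] using this

theorem const_mul (hf : MeanTendsto f a) (c : ℂ) : MeanTendsto (fun m => c * f m) (c * a) := by
  have := Tendsto.const_mul c hf
  simpa [MeanTendsto, ← Finset.mul_sum, mul_left_comm] using this

theorem pow {c : ℂ} (hc : ‖c‖ = 1) (h1 : c ≠ 1) : MeanTendsto (fun m => c ^ m) 0 := by
  rw [MeanTendsto]
  apply squeeze_zero_norm (a := fun N : ℕ => (N : ℝ)⁻¹ * (2 / ‖c - 1‖))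
  · intro N
    rw [geom_sum_eq h1, norm_smul, norm_inv, Real.norm_natCast, norm_div]
    gcongr
    calc ‖c ^ N - 1‖ ≤ ‖c ^ N‖ + ‖(1 : ℂ)‖ := norm_sub_le _ _
      _ = 2 := by rw [norm_pow, hc]; norm_num
  · simpa using (tendsto_inv_atTop_nhds_zero_nat (𝕜 := ℝ)).mul_const (2 / ‖c - 1‖)

theorem const_mul_pow {c : ℂ} (hc : ‖c‖ = 1) (h1 : c ≠ 1) (d : ℂ) :
    MeanTendsto (fun m => d * c ^ m) 0 := by
  simpa using (pow hc h1).const_mul d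

theorem of_abs {w : ℕ → ℝ} {c : ℂ} (hc : ‖c‖ = 1)
    (h : MeanTendsto (fun m => ((|w m| : ℝ) : ℂ)) 0) :
    MeanTendsto (fun m => (w m : ℂ) * c ^ m) 0 := by
  rw [MeanTendsto, tendsto_zero_iff_norm_tendsto_zero] at *
  refine squeeze_zero (fun _ => norm_nonneg _) (fun N => ?_) h
  rw [norm_smul, norm_smul, ← Complex.ofReal_sum, Complex.norm_real,
    Real.norm_of_nonneg (Finset.sum_nonneg fun i _ => abs_nonneg (w i))]
  refine mul_le_mul_of_nonneg_left ((norm_sum_le _ _).trans ?_) (norm_nonneg _)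
  refine Finset.sum_le_sum fun i _ => ?_
  rw [norm_mul, norm_pow, hc, one_pow, mul_one, Complex.norm_real, Real.norm_eq_abs]

end MeanTendsto

theorem conj_mul_self_of_norm_one {a : ℂ} (ha : ‖a‖ = 1) : starRingEnd ℂ a * a = 1 := by
  rw [mul_comm, Complex.mul_conj, Complex.normSq_eq_norm_sq, ha]
  simp

theorem eq_conj_of_mul_eq_one {a b : ℂ} (ha : ‖a‖ = 1) (h : a * b = 1) :
    b = starRingEnd ℂ a := by
  linear_combination starRingEnd ℂ a * h - b * conj_mul_self_of_norm_one ha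

theorem mul_ne_one_of_im_pos {a b : ℂ} (ha : ‖a‖ = 1) (ha' : 0 < a.im) (hb' : 0 < b.im) :
    a * b ≠ 1 := by
  intro h
  rw [eq_conj_of_mul_eq_one ha h, Complex.conj_im] at hb'
  linarith

/-- Two oscillating sequences with different frequencies cannot have eventually the same signs. -/
theorem false_of_eventually_mul_nonneg {u v : ℕ → ℝ} {α β a b : ℂ} (hα : α ≠ 0) (hβ : β ≠ 0)
    (ha : ‖a‖ = 1) (hb : ‖b‖ = 1) (ha' : 0 < a.im) (hb' : 0 < b.im) (hab : a ≠ b)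
    (hu : Tendsto (fun m => u m - (α * a ^ m).re) atTop (𝓝 0))
    (hv : Tendsto (fun m => v m - (β * b ^ m).re) atTop (𝓝 0))
    (huv : ∀ᶠ m in atTop, 0 ≤ u m * v m) : False := by
  have haa := conj_mul_self_of_norm_one ha
  have hbb := conj_mul_self_of_norm_one hb
  set a' := starRingEnd ℂ a with ha'def
  set b' := starRingEnd ℂ b with hb'def
  set α' := starRingEnd ℂ α with hα'def
  set β' := starRingEnd ℂ β with hβ'def
  have hna : ‖a'‖ = 1 := by rw [ha'def, RCLike.norm_conj, ha]
  have hnb : ‖b'‖ = 1 := by rw [hb'def, RCLike.norm_conj, hb]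
  have h1 : a * b ≠ 1 := mul_ne_one_of_im_pos ha ha' hb'
  have h2 : a' * b ≠ 1 := by
    intro h
    apply hab
    have := eq_conj_of_mul_eq_one hna h
    rw [this, ha'def, Complex.conj_conj]
  -- Excluding `-1` as well makes `(a' * b) ^ 2 ≠ 1`, needed after the twist by `a' * b` below.
  have h2' : a' * b ≠ -1 := by
    intro h
    have hb1 : b = -a := by linear_combination a * h - b * haa
    rw [hb1, Complex.neg_im] at hb'
    linarith
  have h3 : a * b' ≠ 1 := by
    intro h
    apply h2
    have := congrArg (starRingEnd ℂ) h
    rwa [map_mul, hb'def, Complex.conj_conj, map_one, ← ha'def] at this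
  have h4 : a' * b' ≠ 1 := by
    intro h
    apply h1
    have := congrArg (starRingEnd ℂ) h
    rwa [map_mul, hb'def, ha'def, Complex.conj_conj, Complex.conj_conj, map_one] at this
  have h5 : b * b ≠ 1 := mul_ne_one_of_im_pos hb hb' hb'
  have h6 : a' * a' ≠ 1 := by
    intro h
    apply mul_ne_one_of_im_pos ha ha' ha'
    have := congrArg (starRingEnd ℂ) h
    rwa [map_mul, ha'def, Complex.conj_conj, map_one] at this
  have h7 : (a' * b) * (a' * b) ≠ 1 := by
    intro h
    rcases mul_self_eq_one_iff.mp h with h | h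
    · exact h2 h
    · exact h2' h
  have hbd : ∀ {γ c : ℂ}, ‖c‖ = 1 →
      IsBoundedUnder (· ≤ ·) atTop ((fun x => ‖x‖) ∘ fun m : ℕ => (γ * c ^ m).re) := by
    intro γ c hc
    refine isBoundedUnder_of ⟨‖γ‖, fun m => ?_⟩
    have := Complex.abs_re_le_norm (γ * c ^ m)
    rwa [norm_mul, norm_pow, hc, one_pow, mul_one] at this
  have he : Tendsto (fun m => ((u m * v m - (α * a ^ m).re * (β * b ^ m).re : ℝ) : ℂ)) atTop
      (𝓝 0) := by
    have e1 := (hu.zero_mul_isBoundedUnder_le (hbd (γ := β) hb)).add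
      ((hv.zero_mul_isBoundedUnder_le (hbd (γ := α) ha)).add (hu.mul hv))
    have e2 := (Complex.continuous_ofReal.tendsto _).comp e1
    simp only [add_zero, mul_zero, Complex.ofReal_zero] at e2
    refine e2.congr fun m => ?_
    simp only [Function.comp_def]
    congr 1
    ring
  have hre (z : ℂ) : ((z.re : ℝ) : ℂ) = (z + starRingEnd ℂ z) / 2 := Complex.re_eq_add_conj z
  have hw (m : ℕ) : ((u m * v m : ℝ) : ℂ) =
      ((u m * v m - (α * a ^ m).re * (β * b ^ m).re : ℝ) : ℂ) + (α * β / 4 * (a * b) ^ m +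
        (α * β' / 4 * (a * b') ^ m + (α' * β / 4 * (a' * b) ^ m +
          α' * β' / 4 * (a' * b') ^ m))) := by
    rw [Complex.ofReal_sub, Complex.ofReal_mul ((α * a ^ m).re), hre, hre]
    simp only [map_mul, map_pow]
    ring
  have hmean : MeanTendsto (fun m => ((u m * v m : ℝ) : ℂ)) 0 := by
    have := (MeanTendsto.of_tendsto he).add
      ((MeanTendsto.const_mul_pow (by rw [norm_mul, ha, hb, one_mul]) h1 (α * β / 4)).add
      ((MeanTendsto.const_mul_pow (by rw [norm_mul, ha, hnb, one_mul]) h3 (α * β' / 4)).add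
      ((MeanTendsto.const_mul_pow (by rw [norm_mul, hna, hb, one_mul]) h2 (α' * β / 4)).add
      (MeanTendsto.const_mul_pow (by rw [norm_mul, hna, hnb, one_mul]) h4 (α' * β' / 4)))))
    simp only [← hw, add_zero] at this
    exact this
  have habs : MeanTendsto (fun m => ((|u m * v m| : ℝ) : ℂ)) 0 := by
    have hz : Tendsto (fun m => (((|u m * v m| - u m * v m : ℝ)) : ℂ)) atTop (𝓝 0) := by
      refine tendsto_const_nhds.congr' ?_
      filter_upwards [huv] with m hm
      rw [abs_of_nonneg hm, sub_self, Complex.ofReal_zero]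
    have := hmean.add (MeanTendsto.of_tendsto hz)
    simpa only [← Complex.ofReal_add, add_sub_cancel, add_zero] using this
  -- The product `u v` has mean zero and is eventually nonnegative, so `|u v|` has mean zero, and so
  -- has any unimodular twist of `u v`. The twist by `(a' * b) ^ m` makes one cross term the
  -- constant `α * β' / 4`, the other terms still averaging to zero.
  have hκ : ‖a' * b‖ = 1 := by rw [norm_mul, hna, hb, one_mul]
  have hlim0 := MeanTendsto.of_abs hκ habs
  have hw' (m : ℕ) : ((u m * v m : ℝ) : ℂ) * (a' * b) ^ m =
      ((u m * v m - (α * a ^ m).re * (β * b ^ m).re : ℝ) : ℂ) * (a' * b) ^ m +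
        (α * β / 4 * (b * b) ^ m + (α * β' / 4 + (α' * β / 4 * ((a' * b) * (a' * b)) ^ m +
          α' * β' / 4 * (a' * a') ^ m))) := by
    have e1 : (a * b) ^ m * (a' * b) ^ m = (b * b) ^ m := by
      rw [← mul_pow]; congr 1; linear_combination b * b * haa
    have e2 : (a * b') ^ m * (a' * b) ^ m = 1 := by
      rw [← mul_pow, show a * b' * (a' * b) = (a' * a) * (b' * b) by ring, haa, hbb]; simp
    have e4 : (a' * b') ^ m * (a' * b) ^ m = (a' * a') ^ m := by
      rw [← mul_pow]; congr 1; linear_combination a' * a' * hbb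
    rw [hw m, mul_pow (a' * b) (a' * b)]
    linear_combination α * β / 4 * e1 + α * β' / 4 * e2 + α' * β' / 4 * e4
  have he' : Tendsto (fun m => ((u m * v m - (α * a ^ m).re * (β * b ^ m).re : ℝ) : ℂ) *
      (a' * b) ^ m) atTop (𝓝 0) := by
    rw [tendsto_zero_iff_norm_tendsto_zero] at he ⊢
    refine he.congr fun m => ?_
    rw [norm_mul, norm_pow, hκ, one_pow, mul_one]
  have hlim1 := (MeanTendsto.of_tendsto he').add
      ((MeanTendsto.const_mul_pow (by rw [norm_mul, hb, one_mul]) h5 (α * β / 4)).add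
      ((MeanTendsto.of_tendsto (tendsto_const_nhds (x := α * β' / 4))).add
      ((MeanTendsto.const_mul_pow (by rw [norm_mul, hκ, one_mul]) h7 (α' * β / 4)).add
      (MeanTendsto.const_mul_pow (by rw [norm_mul, hna, one_mul]) h6 (α' * β' / 4)))))
  simp only [← hw', add_zero, zero_add] at hlim1
  have := tendsto_nhds_unique hlim0 hlim1
  have hne : α * β' / 4 ≠ 0 := by
    have : β' ≠ 0 := by simpa [hβ'def] using hβ
    exact div_ne_zero (mul_ne_zero hα this) (by norm_num)
  exact hne this.symm

end Cesaro

/-! ### Zeros of the denominator `∏ (1 - y i X) + q X ^ r`. -/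

section Denominator

variable {y : ℕ → ℝ} {n r : ℕ} {q : ℝ}

theorem linProd_coeff_zero (y : ℕ → ℝ) (n : ℕ) : (linProd y n).coeff 0 = 1 := by
  rw [coeff_zero_eq_eval_zero, linProd_eval_zero]

theorem linProd_succ_coeff_succ (y : ℕ → ℝ) (n m : ℕ) : (linProd y (n + 1)).coeff (m + 1)
    = (linProd y n).coeff (m + 1) - y n * (linProd y n).coeff m := by
  rw [linProd_succ, mul_sub, mul_one, coeff_sub, mul_left_comm, coeff_C_mul, coeff_mul_X]

theorem linProd_coeff_one_neg (hy : ∀ i, 0 < y i) (hn : 1 ≤ n) : (linProd y n).coeff 1 < 0 := by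
  induction n, hn using Nat.le_induction with
  | base =>
    rw [linProd_succ_coeff_succ, linProd_zero, coeff_one, coeff_one]
    simpa using hy 0
  | succ n _ ih =>
    rw [linProd_succ_coeff_succ, linProd_coeff_zero]
    linarith [hy n]

theorem linProd_coeff_of_le (hy : ∀ i, 0 < y i) (n : ℕ) :
    (linProd y n).coeff n ≠ 0 ∧ ∀ m, n < m → (linProd y n).coeff m = 0 := by
  induction n with
  | zero =>
    rw [linProd_zero]
    exact ⟨by simp, fun m hm => by rw [coeff_one, if_neg (by omega)]⟩
  | succ n ih =>
    constructor
    · rw [linProd_succ_coeff_succ, ih.2 _ (by omega), zero_sub]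
      exact neg_ne_zero.mpr (mul_ne_zero (hy n).ne' ih.1)
    · intro m hm
      obtain ⟨m, rfl⟩ : ∃ k, m = k + 1 := ⟨m - 1, by omega⟩
      rw [linProd_succ_coeff_succ, ih.2 _ (by omega), ih.2 _ (by omega), mul_zero, sub_zero]

theorem aeval_denPoly (z : ℂ) : aeval z (denPoly y n r q) = aeval z (linProd y n) + q * z ^ r := by
  simp [denPoly]

theorem aeval_linProd (z : ℂ) :
    aeval z (linProd y n) = ∏ i ∈ Finset.range n, (1 - (y i : ℂ) * z) := by
  simp [linProd]

theorem aeval_denPoly_zero (hr : 1 ≤ r) : aeval (0 : ℂ) (denPoly y n r q) = 1 := by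
  rw [aeval_denPoly, aeval_linProd, zero_pow (by omega)]
  simp

/-- A constant denominator would need `linProd` to have only the coefficients of `1` and `X ^ r`.
Its leading coefficient then gives `n = r`, and its nonzero linear coefficient gives `r = 1`,
against `hnr`. -/
theorem exists_root_denPoly (hy : ∀ i, 0 < y i) (hn : 1 ≤ n) (hnr : 1 < max n r) :
    ∃ z : ℂ, aeval z (denPoly y n r q) = 0 := by
  by_contra! hno
  have hdeg : (denPoly y n r q).natDegree = 0 := by
    by_contra h
    obtain ⟨z, hz⟩ := Complex.exists_root (f := (denPoly y n r q).map (algebraMap ℝ ℂ))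
      (natDegree_pos_iff_degree_pos.mp (by rw [natDegree_map]; omega))
    rw [IsRoot.def, eval_map_algebraMap] at hz
    exact hno z hz
  have hc (m : ℕ) (hm : 1 ≤ m) (hmr : m ≠ r) : (linProd y n).coeff m = 0 := by
    have h1 : (denPoly y n r q).coeff m = 0 := coeff_eq_zero_of_natDegree_lt (by omega)
    rwa [denPoly, coeff_add, coeff_C_mul, coeff_X_pow, if_neg hmr, mul_zero, add_zero] at h1
  have hnr' : n = r := by
    by_contra h
    exact (linProd_coeff_of_le hy n).1 (hc n hn h)
  exact (linProd_coeff_one_neg hy hn).ne (hc 1 le_rfl (by omega))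

theorem exists_min_root_denPoly (hy : ∀ i, 0 < y i) (hn : 1 ≤ n) (hr : 1 ≤ r)
    (hnr : 1 < max n r) : ∃ t : ℂ, aeval t (denPoly y n r q) = 0 ∧
      ∀ z : ℂ, aeval z (denPoly y n r q) = 0 → ‖t‖ ≤ ‖z‖ := by
  have h0 : (denPoly y n r q).map (algebraMap ℝ ℂ) ≠ 0 := by
    intro h
    have := aeval_denPoly_zero (y := y) (n := n) (q := q) hr
    rw [← eval_map_algebraMap, h, eval_zero] at this
    exact zero_ne_one this
  have hmem (z : ℂ) : z ∈ ((denPoly y n r q).map (algebraMap ℝ ℂ)).roots.toFinset ↔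
      aeval z (denPoly y n r q) = 0 := by
    rw [Multiset.mem_toFinset, mem_roots h0, IsRoot.def, eval_map_algebraMap]
  obtain ⟨z, hz⟩ := exists_root_denPoly (q := q) hy hn hnr
  obtain ⟨t, ht, hmin⟩ := Finset.exists_min_image
    ((denPoly y n r q).map (algebraMap ℝ ℂ)).roots.toFinset (fun z => ‖z‖) ⟨z, (hmem z).mpr hz⟩
  exact ⟨t, (hmem t).mp ht, fun z hz => hmin z ((hmem z).mpr hz)⟩

theorem norm_one_sub_lt {a : ℝ} (ha : 0 < a) {s t : ℂ} (hst : ‖s‖ = ‖t‖) (hre : s.re < t.re) :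
    ‖1 - (a : ℂ) * t‖ < ‖1 - (a : ℂ) * s‖ := by
  have e (z : ℂ) : ‖1 - (a : ℂ) * z‖ ^ 2 = 1 - 2 * a * z.re + a ^ 2 * ‖z‖ ^ 2 := by
    rw [← Complex.normSq_eq_norm_sq, ← Complex.normSq_eq_norm_sq, Complex.normSq_apply,
      Complex.normSq_apply]
    simp
    ring
  apply lt_of_pow_lt_pow_left₀ 2 (norm_nonneg _)
  rw [e, e, hst]
  nlinarith

/-- On a circle, the zeros of `∏ (1 - y i z) + q z ^ r` are at most one conjugate pair. -/
theorem eq_or_eq_conj_of_norm_eq (hq : q ≠ 0) (hy : ∀ i, 0 < y i) (hn : 1 ≤ n) {s t : ℂ}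
    (hs : aeval s (denPoly y n r q) = 0) (ht : aeval t (denPoly y n r q) = 0)
    (hst : ‖s‖ = ‖t‖) : s = t ∨ s = starRingEnd ℂ t := by
  -- On a circle of given radius `∏ |1 - y i z|` must equal `|q|` times the `r`-th power of the
  -- radius, which determines `Re z` by strict monotonicity.
  have key : ∀ {s t : ℂ}, aeval s (denPoly y n r q) = 0 → aeval t (denPoly y n r q) = 0 →
      ‖s‖ = ‖t‖ → t.re ≤ s.re := by
    intro s t hs ht hst
    by_contra! hre
    rw [aeval_denPoly, add_eq_zero_iff_eq_neg, aeval_linProd] at hs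
    rw [aeval_denPoly, add_eq_zero_iff_eq_neg, aeval_linProd] at ht
    have h1 := congrArg norm hs
    have h2 := congrArg norm ht
    rw [norm_neg, norm_mul, norm_pow, hst, norm_prod] at h1
    rw [norm_neg, norm_mul, norm_pow, norm_prod, ← h1] at h2
    refine (Finset.prod_lt_prod_of_nonempty (fun i hi => norm_pos_iff.mpr fun h0 => ?_)
      (fun i _ => norm_one_sub_lt (hy i) hst hre)
      (Finset.nonempty_range_iff.mpr (by omega))).ne h2
    rw [Finset.prod_eq_zero hi h0] at ht
    have ht' := (mul_eq_zero.mp (neg_eq_zero.mp ht.symm)).resolve_left (by exact_mod_cast hq)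
    rw [eq_zero_of_pow_eq_zero ht', mul_zero, sub_zero] at h0
    exact one_ne_zero h0
  have hre : s.re = t.re := le_antisymm (key ht hs hst.symm) (key hs ht hst)
  have him : s.im ^ 2 = t.im ^ 2 := by
    have := congrArg (· ^ 2) hst
    simp only [← Complex.normSq_eq_norm_sq, Complex.normSq_apply] at this
    rw [hre] at this
    linarith
  rcases sq_eq_sq_iff_eq_or_eq_neg.mp him with h | h
  · exact Or.inl (Complex.ext hre h)
  · exact Or.inr (Complex.ext (by simpa using hre) (by simpa using h))

/-- Eliminating `x` between the denominator and its derivative gives `R(t) = 0`, and then `x = -P(t)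
/ t ^ r` is determined by `t`. -/
theorem finite_multiple_roots {p₀ : ℝ} (hp : 0 < p₀) (hy : ∀ i, 0 < y i)
    (hanti : ∀ i j, i ≤ j → j < n → y j ≤ y i) (hr : 1 ≤ r) :
    {x : ℝ | ∃ t : ℂ, aeval t (denPoly y n r (p₀⁻¹ * x)) = 0 ∧
      aeval t (derivative (denPoly y n r (p₀⁻¹ * x))) = 0}.Finite := by
  have h0 : (critPoly (C p₀ * linProd y n) r).map (algebraMap ℝ ℂ) ≠ 0 :=
    (Polynomial.map_ne_zero_iff (algebraMap ℝ ℂ).injective).mpr (critPoly_ne_zero hp hy hanti hr)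
  have hfin := ((Polynomial.finite_setOfPred_isRoot h0).image
    fun t : ℂ => -(p₀ * aeval t (linProd y n)) / t ^ r).preimage
      (Complex.ofReal_injective.injOn (s := Complex.ofReal ⁻¹' _))
  refine hfin.subset ?_
  rintro x ⟨t, ht, ht'⟩
  have hp' : (p₀ : ℂ) ≠ 0 := by exact_mod_cast hp.ne'
  have ht0 : t ≠ 0 := by
    rintro rfl
    rw [aeval_denPoly_zero hr] at ht
    exact one_ne_zero ht
  rw [aeval_denPoly] at ht
  have hd : aeval t (derivative (linProd y n)) + ((p₀⁻¹ * x : ℝ) : ℂ) * (r * t ^ (r - 1)) = 0 := by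
    rw [← ht']
    simp [denPoly, derivative_X_pow]
  refine ⟨t, ?_, ?_⟩
  · show IsRoot _ _
    rw [IsRoot.def, eval_map_algebraMap]
    obtain ⟨r, rfl⟩ : ∃ k, r = k + 1 := ⟨r - 1, by omega⟩
    simp only [critPoly, map_sub, map_mul, map_pow, aeval_C, aeval_X, derivative_C_mul,
      Complex.coe_algebraMap, Nat.add_sub_cancel] at hd ⊢
    push_cast at ht hd ⊢
    linear_combination (p₀ : ℂ) * (r + 1) * t ^ r * ht - p₀ * t ^ (r + 1) * hd
  · show -(p₀ * aeval t (linProd y n)) / t ^ r = (x : ℂ)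
    rw [div_eq_iff (pow_ne_zero r ht0)]
    push_cast at ht
    have : (p₀ : ℂ) * ((p₀ : ℂ)⁻¹ * x * t ^ r) = x * t ^ r := by field_simp
    linear_combination -(p₀ : ℂ) * ht + this

/-- The relation becomes a polynomial identity in `T`. Its constant term gives `conj ω ^ r = ω ^ r`,
and its linear term, `linProd` having a nonzero linear coefficient, gives `ω = conj ω`. -/
theorem im_eq_zero_of_infinite (hy : ∀ i, 0 < y i) (hn : 1 ≤ n) {ω : ℂ} (hω : ‖ω‖ = 1)
    {S : Set ℝ} (hS : S.Infinite) (h : ∀ T ∈ S, aeval ((T : ℂ) * ω) (linProd y n) *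
      starRingEnd ℂ ω ^ r = aeval ((T : ℂ) * starRingEnd ℂ ω) (linProd y n) * ω ^ r) :
    ω.im = 0 := by
  set L := (linProd y n).map (algebraMap ℝ ℂ) with hL
  set W : ℂ[X] := L.comp (C ω * X) * C (starRingEnd ℂ ω ^ r) -
    L.comp (C (starRingEnd ℂ ω) * X) * C (ω ^ r) with hW
  have hW0 : W = 0 := by
    refine eq_zero_of_infinite_isRoot _
      ((hS.image Complex.ofReal_injective.injOn).mono ?_)
    rintro _ ⟨T, hT, rfl⟩
    have := h T hT
    simp only [← eval_map_algebraMap, ← hL] at this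
    show IsRoot _ _
    rw [IsRoot.def, hW]
    simp only [eval_sub, eval_mul, eval_comp, eval_C, eval_X]
    rw [mul_comm ω, mul_comm (starRingEnd ℂ ω) (T : ℂ), this, sub_self]
  have h0 := congrArg (fun p => coeff p 0) hW0
  have h1 := congrArg (fun p => coeff p 1) hW0
  simp only [hW, coeff_sub, coeff_mul_C, comp_C_mul_X_coeff, hL, coeff_map, linProd_coeff_zero,
    coeff_zero, map_one, pow_zero, one_mul, pow_one, mul_one] at h0 h1
  have hl : (algebraMap ℝ ℂ) ((linProd y n).coeff 1) ≠ 0 := by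
    simpa using (linProd_coeff_one_neg hy hn).ne
  have hω0 : ω ≠ 0 := by
    rintro rfl
    simp at hω
  rw [sub_eq_zero.mp h0] at h1
  have h2 : (algebraMap ℝ ℂ) ((linProd y n).coeff 1) * ω ^ r * (ω - starRingEnd ℂ ω) = 0 := by
    linear_combination h1
  have h3 := (mul_eq_zero.mp h2).resolve_left (mul_ne_zero hl (pow_ne_zero r hω0))
  exact Complex.conj_eq_iff_im.mp (sub_eq_zero.mp h3).symm

end Denominator

/-! ### Density of the zeros. -/

section Density

open Filter Topology

variable {p₀ : ℝ} {y : ℕ → ℝ} {n r : ℕ}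

theorem tendsto_coeff_linProd_mul {F : PowerSeries ℝ} {s β : ℝ}
    (h : Tendsto (fun m => PowerSeries.coeff m F * s ^ m) atTop (𝓝 β)) (j : ℕ) :
    Tendsto (fun m => PowerSeries.coeff m ((linProd y j : PowerSeries ℝ) * F) * s ^ m) atTop
      (𝓝 ((linProd y j).eval s * β)) := by
  induction j with
  | zero => simpa [linProd_zero] using h
  | succ j ih =>
    rw [← tendsto_add_atTop_iff_nat 1]
    have h1 := (ih.comp (tendsto_add_atTop_nat 1)).sub (ih.const_mul (y j * s))
    have e : (linProd y j).eval s * β - y j * s * ((linProd y j).eval s * β)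
        = (linProd y (j + 1)).eval s * β := by
      rw [linProd_succ, eval_mul]
      simp
      ring
    rw [e] at h1
    refine h1.congr fun m => ?_
    simp only [Function.comp_def]
    rw [linProd_succ, Polynomial.coe_mul, Polynomial.coe_sub, Polynomial.coe_one,
      Polynomial.coe_mul, Polynomial.coe_C, Polynomial.coe_X,
      show (linProd y j : PowerSeries ℝ) * (1 - PowerSeries.C (y j) * PowerSeries.X) * F
        = (linProd y j : PowerSeries ℝ) * F - PowerSeries.C (y j) *
          (PowerSeries.X * ((linProd y j : PowerSeries ℝ) * F)) by ring,
      map_sub, PowerSeries.coeff_C_mul, PowerSeries.coeff_succ_X_mul]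
    ring

/-- Multiplication by `linProd y j` scales the limit by its value at `s`; for `j = 0, 1, 2` these
values have the forbidden signs `+, -, +`. -/
theorem false_of_tendsto_column (hp : 0 < p₀) (hr : 1 ≤ r) (hn : 3 ≤ n) (hy : ∀ i, 0 < y i)
    {x s β : ℝ} (hβ : β ≠ 0) (h0 : 1 < y 0 * s) (h1 : 1 < y 1 * s)
    (h : Tendsto (fun m => PowerSeries.coeff m (genSeries p₀ y n r x) * s ^ m) atTop (𝓝 β)) :
    False := by
  have hββ : 0 < β * β := mul_self_pos.mpr hβ
  have key (j : ℕ) := (tendsto_coeff_linProd_mul (y := y) h j).const_mul β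
  have e1 : (linProd y 1).eval s < 0 := by
    simpa [linProd_succ, linProd_zero] using h0
  have e2 : 0 < (linProd y 2).eval s := by
    have := mul_pos_of_neg_of_neg (sub_neg.mpr h0) (sub_neg.mpr h1)
    simpa [linProd_succ, linProd_zero] using this
  have k0 := (key 0).eventually_const_lt (u := 0) (by rw [linProd_zero]; simpa using hβ)
  have k1 := (key 1).eventually_lt_const (u := 0) (by nlinarith)
  have k2 := (key 2).eventually_const_lt (u := 0) (by nlinarith)
  obtain ⟨m, ⟨hm0, hm1⟩, hm2⟩ := ((k0.and k1).and k2).exists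
  refine genSeries_not_sign_pattern_column hp hr hn hy x (β * s ^ m) m ?_ ?_ ?_ <;> linarith

theorem false_of_tendsto_row (hp : 0 < p₀) (hr : 3 ≤ r) (hn : 1 ≤ n) (hy : ∀ i, 0 < y i)
    {x s β : ℝ} (hβ : β ≠ 0) (hs : s < 0)
    (h : Tendsto (fun m => PowerSeries.coeff m (genSeries p₀ y n r x) * s ^ m) atTop (𝓝 β)) :
    False := by
  have hββ : 0 < β * β := mul_self_pos.mpr hβ
  have key := h.const_mul β
  have k0 := key.eventually_const_lt (u := 0) hββ
  obtain ⟨N, hN⟩ := eventually_atTop.mp k0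
  have hs2 : 0 < s ^ 2 := sq_pos_of_neg hs
  have m0 := hN N le_rfl
  have m1 := hN (N + 1) (by omega)
  have m2 := hN (N + 2) (by omega)
  refine genSeries_not_sign_pattern_row hp hr hn hy x (β * s ^ N) N (by linarith) ?_ ?_
  · by_contra! hc
    have := mul_nonpos_of_nonpos_of_nonneg hs.le hc
    rw [pow_succ] at m1
    linarith
  · by_contra! hc
    have := mul_nonpos_of_nonneg_of_nonpos hs2.le hc
    rw [pow_add] at m2
    linarith

/-- The root satisfies `x = -P(s) / s ^ r`. The bounds `a < x < b` exclude `s < 0` with `r = 1` and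
`s` between the two smallest zeros of `P`; the sign patterns exclude the rest. -/
theorem false_of_real_min_root (hp : 0 < p₀) (hy : ∀ i, 0 < y i)
    (hanti : ∀ i j, i ≤ j → j < n → y j ≤ y i) (hr : 1 ≤ r) (hn : 1 ≤ n) {ta tb : ℝ}
    (hta : IsLeast {t : ℝ | 0 < t ∧ (critPoly (C p₀ * linProd y n) r).IsRoot t} ta)
    (htb : IsGreatest {t : ℝ | t ≤ 0 ∧ (critPoly (C p₀ * linProd y n) r).IsRoot t} tb)
    {x : ℝ} (hax : leftEnd (C p₀ * linProd y n) r ta < x)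
    (hxb : (x : EReal) < rightEnd (C p₀ * linProd y n) tb) {s : ℝ}
    (hs : aeval (s : ℂ) (denPoly y n r (p₀⁻¹ * x)) = 0)
    (hs' : aeval (s : ℂ) (derivative (denPoly y n r (p₀⁻¹ * x))) ≠ 0)
    (hmin : ∀ z : ℂ, aeval z (denPoly y n r (p₀⁻¹ * x)) = 0 → ‖z‖ ≤ |s| → z = s) : False := by
  obtain ⟨β, hβ, hlim⟩ := exists_tendsto_of_real_root (denPoly_mul_genSeries hp.ne' hr x) hs hs'
    hmin
  obtain ⟨ha0, -, hamax⟩ := leftEnd_spec hp hy hanti hr hn hta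
  have hx : 0 < x := ha0.trans_lt hax
  have hs0 : s ≠ 0 := by
    rintro rfl
    rw [Complex.ofReal_zero, aeval_denPoly_zero hr] at hs
    exact one_ne_zero hs
  have hPs : p₀ * (linProd y n).eval s = -(x * s ^ r) := by
    have h1 := Polynomial.aeval_algebraMap_apply ℂ s (denPoly y n r (p₀⁻¹ * x))
    rw [Complex.coe_algebraMap, hs, Polynomial.coe_aeval_eq_eval] at h1
    have h2 : (denPoly y n r (p₀⁻¹ * x)).eval s = 0 := by exact_mod_cast h1.symm
    simp only [denPoly, eval_add, eval_mul, eval_C, eval_pow, eval_X] at h2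
    have h3 : p₀ * (p₀⁻¹ * x * s ^ r) = x * s ^ r := by field_simp
    linear_combination p₀ * h2 - h3
  have hpsi : -(C p₀ * linProd y n).eval s / s ^ r = x := by
    rw [eval_C_mul, hPs, neg_neg, mul_div_assoc, div_self (pow_ne_zero r hs0), mul_one]
  rcases lt_or_gt_of_ne hs0 with hneg | hpos
  · have hL : 0 < (linProd y n).eval s := linProd_eval_pos fun i _ =>
      (mul_neg_of_pos_of_neg (hy i) hneg).trans one_pos
    -- `P(s)` and `x` are both positive, so `s ^ r` must be negative.
    have hodd : Odd r := by
      by_contra h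
      have := (Nat.not_odd_iff_even.mp h).pow_pos hs0
      have := mul_pos hp hL
      have : 0 < x * s ^ r := by positivity
      linarith
    obtain ⟨k, rfl⟩ := hodd
    rcases Nat.eq_zero_or_pos k with rfl | hk
    · obtain ⟨htb0, hbmin⟩ := rightEnd_spec hp hy hn htb
      rw [rightEnd, if_neg htb0.ne, EReal.coe_lt_coe_iff] at hxb
      have := hbmin s hneg
      rw [← hpsi] at hxb
      simp only [mul_zero, zero_add, pow_one] at hxb
      linarith
    · exact false_of_tendsto_row hp (by omega) hn hy hβ hneg hlim
  · have hL : (linProd y n).eval s < 0 := by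
      by_contra! h
      have := mul_nonneg hp.le h
      have : 0 < x * s ^ r := by positivity
      linarith
    have hne : ∀ i < n, y i * s ≠ 1 := by
      intro i hi h
      rw [eval_linProd, Finset.prod_eq_zero (Finset.mem_range.mpr hi) (by rw [h, sub_self])] at hL
      exact lt_irrefl _ hL
    by_cases hall : ∀ i < n, 1 ≤ i → y i * s < 1
    · rcases lt_or_ge 1 (y 0 * s) with h0 | h0
      · have := hamax s h0 hall
        rw [hpsi] at this
        linarith
      · refine hL.not_ge (linProd_eval_pos fun i hi => ?_).le
        rcases Nat.eq_zero_or_pos i with rfl | hi1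
        · exact lt_of_le_of_ne h0 (hne 0 hi)
        · exact hall i hi hi1
    · push Not at hall
      obtain ⟨i, hi, hi1, his⟩ := hall
      have h1 : 1 < y 1 * s := lt_of_le_of_ne
        (his.trans (mul_le_mul_of_nonneg_right (hanti 1 i hi1 hi) hpos.le)) (hne 1 (by omega)).symm
      have h0 : 1 < y 0 * s := h1.trans_le
        (mul_le_mul_of_nonneg_right (hanti 0 1 (by omega) (by omega)) hpos.le)
      -- With only two factors, both negative, `P(s)` would be positive.
      have hn3 : 3 ≤ n := by
        by_contra h
        obtain rfl : n = 2 := by omega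
        have := mul_pos_of_neg_of_neg (sub_neg.mpr h0) (sub_neg.mpr h1)
        simp only [linProd_succ, linProd_zero, eval_mul, eval_one, one_mul, eval_sub, eval_C,
          eval_X] at hL
        linarith
      exact false_of_tendsto_column hp hr hn3 hy hβ h0 h1 hlim

theorem exists_upper_min_root (hp : 0 < p₀) (hy : ∀ i, 0 < y i)
    (hanti : ∀ i j, i ≤ j → j < n → y j ≤ y i) (hr : 1 ≤ r) (hn : 1 ≤ n) (hnr : 1 < max n r)
    {ta tb : ℝ}
    (hta : IsLeast {t : ℝ | 0 < t ∧ (critPoly (C p₀ * linProd y n) r).IsRoot t} ta)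
    (htb : IsGreatest {t : ℝ | t ≤ 0 ∧ (critPoly (C p₀ * linProd y n) r).IsRoot t} tb)
    {x : ℝ} (hax : leftEnd (C p₀ * linProd y n) r ta < x)
    (hxb : (x : EReal) < rightEnd (C p₀ * linProd y n) tb)
    (hx : ¬∃ t : ℂ, aeval t (denPoly y n r (p₀⁻¹ * x)) = 0 ∧
      aeval t (derivative (denPoly y n r (p₀⁻¹ * x))) = 0) :
    ∃ t : ℂ, 0 < t.im ∧ aeval t (denPoly y n r (p₀⁻¹ * x)) = 0 ∧ ∃ β : ℂ, β ≠ 0 ∧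
      Tendsto (fun m => PowerSeries.coeff m (genSeries p₀ y n r x) * ‖t‖ ^ m -
        (β * (t / ‖t‖) ^ m).re) atTop (𝓝 0) := by
  have hx0 : 0 < x := (leftEnd_spec hp hy hanti hr hn hta).1.trans_lt hax
  have hq : p₀⁻¹ * x ≠ 0 := mul_ne_zero (inv_ne_zero hp.ne') hx0.ne'
  push Not at hx
  have key : ∀ t : ℂ, aeval t (denPoly y n r (p₀⁻¹ * x)) = 0 →
      (∀ z : ℂ, aeval z (denPoly y n r (p₀⁻¹ * x)) = 0 → ‖t‖ ≤ ‖z‖) → 0 < t.im →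
      ∃ t : ℂ, 0 < t.im ∧ aeval t (denPoly y n r (p₀⁻¹ * x)) = 0 ∧ ∃ β : ℂ, β ≠ 0 ∧
      Tendsto (fun m => PowerSeries.coeff m (genSeries p₀ y n r x) * ‖t‖ ^ m -
        (β * (t / ‖t‖) ^ m).re) atTop (𝓝 0) := fun t ht hmin him =>
    ⟨t, him, ht, exists_tendsto_of_nonreal_root (denPoly_mul_genSeries hp.ne' hr x) him.ne' ht
      (hx t ht) fun z hz hzt => eq_or_eq_conj_of_norm_eq hq hy hn hz ht
        (le_antisymm hzt (hmin z hz))⟩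
  obtain ⟨t, ht, hmin⟩ := exists_min_root_denPoly (q := p₀⁻¹ * x) hy hn hr hnr
  rcases lt_trichotomy 0 t.im with him | him | him
  · exact key t ht hmin him
  · have hts : t = (t.re : ℂ) := Complex.ext (by simp) (by simp [← him])
    have habs : ‖t‖ = |t.re| := by rw [hts, Complex.norm_real, Complex.ofReal_re, Real.norm_eq_abs]
    refine (false_of_real_min_root hp hy hanti hr hn hta htb hax hxb (s := t.re) (hts ▸ ht)
      (hts ▸ hx t ht) fun z hz hzt => ?_).elim
    rcases eq_or_eq_conj_of_norm_eq hq hy hn hz ht (le_antisymm (hzt.trans habs.ge) (hmin z hz))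
      with h | h
    · rw [h]; exact hts
    · rw [h, Complex.conj_eq_iff_im.mpr him.symm]; exact hts
  · exact key (starRingEnd ℂ t) (by rw [aeval_conj, ht, map_zero])
      (fun z hz => by rw [RCLike.norm_conj]; exact hmin z hz) (by simpa using him)

theorem mul_pos_of_no_root {p : ℝ[X]} {c d u v : ℝ} (hu : u ∈ Set.Ioo c d) (hv : v ∈ Set.Ioo c d)
    (h : ∀ x ∈ Set.Ioo c d, ¬p.IsRoot x) : 0 < p.eval u * p.eval v := by
  by_contra! hneg
  have hsub : Set.uIcc u v ⊆ Set.Ioo c d := fun w hw =>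
    ⟨(lt_min hu.1 hv.1).trans_le hw.1, hw.2.trans_lt (max_lt hu.2 hv.2)⟩
  have h0 : (0 : ℝ) ∈ Set.uIcc (p.eval u) (p.eval v) := by
    rw [Set.mem_uIcc]
    rcases le_total (p.eval u) 0 with h1 | h1 <;> rcases le_total (p.eval v) 0 with h2 | h2
    · rcases eq_or_lt_of_le h1 with h3 | h3
      · exact Or.inr ⟨h2, h3.ge⟩
      · exact Or.inl ⟨h1, by nlinarith⟩
    · exact Or.inl ⟨h1, h2⟩
    · exact Or.inr ⟨h2, h1⟩
    · rcases eq_or_lt_of_le h1 with h3 | h3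
      · exact Or.inl ⟨h3.ge, h2⟩
      · exact Or.inr ⟨by nlinarith, h1⟩
  obtain ⟨w, hw, hw0⟩ := intermediate_value_uIcc p.continuous.continuousOn h0
  exact h w (hsub hw) hw0

theorem zeros_dense (hp : 0 < p₀) (hy : ∀ i, 0 < y i)
    (hanti : ∀ i j, i ≤ j → j < n → y j ≤ y i) (hr : 1 ≤ r) (hn : 1 ≤ n) (hnr : 1 < max n r)
    {ta tb : ℝ}
    (hta : IsLeast {t : ℝ | 0 < t ∧ (critPoly (C p₀ * linProd y n) r).IsRoot t} ta)
    (htb : IsGreatest {t : ℝ | t ≤ 0 ∧ (critPoly (C p₀ * linProd y n) r).IsRoot t} tb) (M : ℕ) :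
    {x : ℝ | leftEnd (C p₀ * linProd y n) r ta < x ∧
        (x : EReal) < rightEnd (C p₀ * linProd y n) tb} ⊆
      closure {x : ℝ | ∃ m : ℕ, M ≤ m ∧ (genPoly (C p₀ * linProd y n) r m).IsRoot x} := by
  intro x₀ hx₀
  by_contra hcl
  set a := leftEnd (C p₀ * linProd y n) r ta
  set b := rightEnd (C p₀ * linProd y n) tb
  set Z := {x : ℝ | ∃ m : ℕ, M ≤ m ∧ (genPoly (C p₀ * linProd y n) r m).IsRoot x}
  have hopen : IsOpen ({x : ℝ | a < x ∧ (x : EReal) < b} ∩ (closure Z)ᶜ) :=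
    ((isOpen_lt continuous_const continuous_id).inter
      (isOpen_lt continuous_coe_real_ereal continuous_const)).inter isClosed_closure.isOpen_compl
  obtain ⟨c, d, hcd, hsub⟩ := mem_nhds_iff_exists_Ioo_subset.mp (hopen.mem_nhds ⟨hx₀, hcl⟩)
  have hroot : ∀ m, M ≤ m → ∀ x ∈ Set.Ioo c d,
      ¬(genPoly (C p₀ * linProd y n) r m).IsRoot x := fun m hm x hx h =>
    (hsub hx).2 (subset_closure ⟨m, hm, h⟩)
  set G := Set.Ioo c d \ {x : ℝ | ∃ t : ℂ, aeval t (denPoly y n r (p₀⁻¹ * x)) = 0 ∧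
      aeval t (derivative (denPoly y n r (p₀⁻¹ * x))) = 0}
  have hG : G.Infinite :=
    (Set.Ioo_infinite (hcd.1.trans hcd.2)).sdiff (finite_multiple_roots hp hy hanti hr)
  choose! t him ht β hβ hlim using fun x (hx : x ∈ G) => exists_upper_min_root hp hy hanti hr hn
    hnr hta htb (hsub hx.1).1.1 (hsub hx.1).1.2 hx.2
  have ht0 : ∀ x ∈ G, (‖t x‖ : ℂ) ≠ 0 := fun x hx => by
    have : t x ≠ 0 := fun h => by
      have := him x hx
      simp [h] at this
    simpa using this
  have hnorm : ∀ x ∈ G, ‖t x / ‖t x‖‖ = 1 := fun x hx => by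
    rw [norm_div, Complex.norm_real, norm_norm]
    exact div_self (by simpa using ht0 x hx)
  have himpos : ∀ x ∈ G, 0 < (t x / ‖t x‖).im := fun x hx => by
    rw [Complex.div_ofReal_im]
    have h1 : ‖t x‖ ≠ 0 := by simpa using ht0 x hx
    exact div_pos (him x hx) (lt_of_le_of_ne (norm_nonneg _) h1.symm)
  obtain ⟨x₁, hx₁⟩ := hG.nonempty
  -- If all roots had one direction `ω`, their moduli would be distinct, since the root determines
  -- `x`. Eliminating `x` between the root equation and its conjugate would then give the relation
  -- of `im_eq_zero_of_infinite` at infinitely many `T`.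
  obtain ⟨x₂, hx₂, hne⟩ : ∃ x₂ ∈ G, t x₁ / ‖t x₁‖ ≠ t x₂ / ‖t x₂‖ := by
    by_contra! hall
    set ω := t x₁ / ‖t x₁‖
    have hωn : ‖ω‖ = 1 := hnorm x₁ hx₁
    have htω : ∀ x ∈ G, t x = ‖t x‖ * ω := fun x hx => by
      rw [hall x hx, mul_div_cancel₀ _ (ht0 x hx)]
    have heq : ∀ x ∈ G, aeval ((‖t x‖ : ℂ) * ω) (linProd y n)
        = -(((p₀⁻¹ * x : ℝ) : ℂ) * (‖t x‖ * ω) ^ r) := fun x hx => by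
      have := ht x hx
      rw [aeval_denPoly, htω x hx] at this
      linear_combination this
    have hinj : Set.InjOn (fun x => ‖t x‖) G := by
      intro x hx x' hx' hxx'
      have hxx' : ‖t x‖ = ‖t x'‖ := hxx'
      have h1 := heq x hx
      rw [hxx', heq x' hx', neg_inj] at h1
      have h2 : ((‖t x'‖ : ℂ) * ω) ^ r ≠ 0 := by
        apply pow_ne_zero
        apply mul_ne_zero (ht0 x' hx')
        rintro h
        simp [h] at hωn
      have h3 := mul_right_cancel₀ h2 h1
      have h4 : p₀⁻¹ * x' = p₀⁻¹ * x := by exact_mod_cast h3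
      exact (mul_left_cancel₀ (inv_ne_zero hp.ne') h4).symm
    refine (himpos x₁ hx₁).ne' (im_eq_zero_of_infinite (r := r) hy hn hωn (hG.image hinj) ?_)
    rintro _ ⟨x, hx, rfl⟩
    have h1 := heq x hx
    have h2 : aeval ((‖t x‖ : ℂ) * starRingEnd ℂ ω) (linProd y n)
        = -(((p₀⁻¹ * x : ℝ) : ℂ) * (‖t x‖ * starRingEnd ℂ ω) ^ r) := by
      have := congrArg (starRingEnd ℂ) h1
      rw [← aeval_conj] at this
      simpa only [map_mul, map_neg, map_pow, Complex.conj_ofReal] using this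
    simp only []
    rw [h1, h2, mul_pow, mul_pow]
    ring
  refine false_of_eventually_mul_nonneg (hβ x₁ hx₁) (hβ x₂ hx₂) (hnorm x₁ hx₁) (hnorm x₂ hx₂)
    (himpos x₁ hx₁) (himpos x₂ hx₂) hne (hlim x₁ hx₁) (hlim x₂ hx₂) ?_
  filter_upwards [eventually_ge_atTop M] with m hm
  have := mul_pos_of_no_root hx₁.1 hx₂.1 (hroot m hm)
  rw [coeff_genSeries, coeff_genSeries]
  have h2 : 0 ≤ p₀ * p₀ * (‖t x₁‖ ^ m * ‖t x₂‖ ^ m) := by positivity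
  linarith [mul_nonneg h2 this.le]

end Density

/-! ### Location of the zeros and conclusion. -/

theorem genPoly_zeros_mem {p₀ : ℝ} {y : ℕ → ℝ} {n r : ℕ} (hp : 0 < p₀) (hy : ∀ i, 0 < y i)
    (hanti : ∀ i j, i ≤ j → j < n → y j ≤ y i) (hr : 1 ≤ r) (hn : 1 ≤ n) {ta tb : ℝ}
    (hta : IsLeast {t : ℝ | 0 < t ∧ (critPoly (C p₀ * linProd y n) r).IsRoot t} ta)
    (htb : IsGreatest {t : ℝ | t ≤ 0 ∧ (critPoly (C p₀ * linProd y n) r).IsRoot t} tb) (m : ℕ)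
    {z : ℂ} (hz : aeval z (genPoly (C p₀ * linProd y n) r m) = 0) :
    ∃ x : ℝ, z = (x : ℂ) ∧ leftEnd (C p₀ * linProd y n) r ta < x ∧
      (x : EReal) < rightEnd (C p₀ * linProd y n) tb := by
  obtain ⟨x, rfl⟩ : ∃ x : ℝ, z = (x : ℂ) := by
    refine ⟨z.re, Complex.ext (by simp) ?_⟩
    by_contra him
    exact aeval_genPoly_ne_zero_of_im_ne_zero hp hy hr hn (by simpa using him) m hz
  have hx : (genPoly (C p₀ * linProd y n) r m).eval x = 0 := by
    have h1 := Polynomial.aeval_algebraMap_apply ℂ x (genPoly (C p₀ * linProd y n) r m)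
    rw [Complex.coe_algebraMap, hz, Polynomial.coe_aeval_eq_eval] at h1
    exact_mod_cast h1.symm
  have hx0 : 0 < x := by
    by_contra! h
    exact (genPoly_eval_pos_of_nonpos hp hy hr hn h m).ne' hx
  refine ⟨x, rfl, ?_, ?_⟩
  · by_contra! hle
    obtain ⟨-, hother, -⟩ := leftEnd_spec hp hy hanti hr hn hta
    have hta0 : 0 < ta := hta.1.1
    -- With `T = ta`, the condition that the denominator be nonpositive at `T` is exactly `x ≤ a`;
    -- `a > 0` follows from `0 < x ≤ a`.
    refine (genPoly_eval_pos_of_le hp hy hr hn hx0.le hta0 (hother (hx0.trans_le hle)) ?_ m).ne' hx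
    rw [leftEnd, le_div_iff₀ (pow_pos hta0 r), eval_C_mul] at hle
    linarith
  · by_contra! hge
    rw [rightEnd] at hge
    split_ifs at hge with htb0
    · exact (EReal.coe_lt_top x).not_ge hge
    -- For `r ≥ 2` zero is a root of `critPoly`, so `tb = 0`.
    · have hr1 : r = 1 := by
        by_contra h
        exact htb0 (le_antisymm htb.1.1 (htb.2 ⟨le_rfl, critPoly_isRoot_zero (by omega) _⟩))
      subst hr1
      have htbneg : tb < 0 := lt_of_le_of_ne htb.1.1 htb0
      rw [EReal.coe_le_coe_iff, div_le_iff_of_neg htbneg, eval_C_mul] at hge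
      -- With `T = -tb`, the hypothesis `P(-T) ≤ x T` is exactly `b ≤ x`.
      have := genPoly_eval_alternating (n := n) hp hy (x := x) (T := -tb) (by linarith)
        (by rw [neg_neg]; linarith) m
      rw [hx, mul_zero] at this
      exact lt_irrefl _ this

theorem theorem1 (P : ℝ[X]) (r : ℕ)
    (hdeg : 1 ≤ P.natDegree)
    (hzeros : ∀ t : ℂ, aeval t P = 0 → ∃ x : ℝ, 0 < x ∧ t = (x : ℂ))
    (hP0 : 0 < P.eval 0)
    (hr : 1 ≤ r)
    (hmax : 1 < max P.natDegree r) :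
    ∃ ta tb : ℝ,
      IsLeast {t : ℝ | 0 < t ∧ (critPoly P r).IsRoot t} ta ∧
      IsGreatest {t : ℝ | t ≤ 0 ∧ (critPoly P r).IsRoot t} tb ∧
      (∃ M : ℕ, ∀ m : ℕ, M ≤ m → ∀ z : ℂ, aeval z (genPoly P r m) = 0 →
        ∃ x : ℝ, z = (x : ℂ) ∧ leftEnd P r ta < x ∧ (x : EReal) < rightEnd P tb) ∧
      (∀ M : ℕ, {x : ℝ | leftEnd P r ta < x ∧ (x : EReal) < rightEnd P tb} ⊆
        closure {x : ℝ | ∃ m : ℕ, M ≤ m ∧ (genPoly P r m).IsRoot x}) := by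
  obtain ⟨y, hy, hanti, hP⟩ := exists_factorization hzeros
  generalize P.natDegree = n at *
  generalize P.eval 0 = p₀ at *
  subst hP
  have hfin := finite_critPoly_roots hP0 hy hanti hr
  have hta : ∃ ta, IsLeast {t : ℝ | 0 < t ∧ (critPoly (C p₀ * linProd y n) r).IsRoot t} ta := by
    obtain ⟨t, ht⟩ := exists_pos_critPoly_root (p₀ := p₀) hy hanti hr hdeg hmax
    obtain ⟨s, hs, hmin⟩ := Set.exists_min_image _ id
      (hfin.subset fun t (ht : 0 < t ∧ _) => ht.2) ⟨t, ht⟩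
    exact ⟨s, hs, hmin⟩
  have htb : ∃ tb, IsGreatest {t : ℝ | t ≤ 0 ∧ (critPoly (C p₀ * linProd y n) r).IsRoot t} tb := by
    rcases hr.eq_or_lt with rfl | hr2
    · obtain ⟨t, ht⟩ := exists_neg_critPoly_root hP0 hy hanti (n := n) (by omega)
      obtain ⟨s, hs, hmax⟩ := Set.exists_max_image _ id
        (hfin.subset fun t (ht : t ≤ 0 ∧ _) => ht.2) ⟨t, ht⟩
      exact ⟨s, hs, hmax⟩
    · exact ⟨0, ⟨le_rfl, critPoly_isRoot_zero hr2 _⟩, fun t ht => ht.1⟩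
  obtain ⟨ta, hta⟩ := hta
  obtain ⟨tb, htb⟩ := htb
  -- `M = 0` suffices: the zeros are real and in `(a, b)` for every `m`.
  exact ⟨ta, tb, hta, htb,
    ⟨0, fun m _ z hz => genPoly_zeros_mem hP0 hy hanti hr hdeg hta htb m hz⟩,
    zeros_dense hP0 hy hanti hr hdeg hmax hta htb⟩
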